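/- Let $\mathcal{B}$ be a finite set of subsets ("concepts") of a finite set $V$. A positive non-clashing teaching map for $\mathcal{B}$ is a map $T$ that assigns to each $B\in\mathcal{B}$ a set $T(B)\subseteq B$ such that for any two distinct $B,B'\in\mathcal{B}$ some $w\in T(B)\cup T(B')$ lies in exactly one of $B$ and $B'$; its size is $\max_{B\in\mathcal{B}}|T(B)|$, and $\mathrm{NCTD}^+(\mathcal{B})$ is the smallest size of such a map. The problem N-NCTD$^+$ takes as input a finite simple graph $G$, a set $\mathcal{B}$ of closed neighborhoods $N[v]$ of vertices $v$ of $G$, and a positive integer $k$, and asks whether $\mathrm{NCTD}^+(\mathcal{B})\le k$. The Exponential Time Hypothesis (ETH) states that 3-SAT with $n$ variables and $m$ clauses cannot be solved in $2^{o(n+m)}$ time. Theorem. Unless the ETH fails, N-NCTD$^+$ cannot be solved in $2^{o(f(k)\cdot(|V(G)|+|E(G)|))}$ time for any computable function $f:\mathbb{N}\to\mathbb{N}$, not even up to a factor that is polynomial in the length of the input. -/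

import Mathlib

open Filter Asymptotics

/-! ## Teaching: concepts, positive teaching maps, the dimension `NCTD⁺` -/

section Teaching

variable {V : Type*} [DecidableEq V]

/-- `T` is a positive non-clashing teaching map for the finite concept class `𝓑` of subsets of `V`:
every example that `T` presents for a concept `B` is positive and consistent, that is, `T B ⊆ B`,
and for any two distinct concepts some presented example lies in exactly one of the two.
(Only the values of `T` on `𝓑` matter.) -/
def IsPositiveNCTM (𝓑 : Finset (Finset V)) (T : Finset V → Finset V) : Prop :=
  (∀ B ∈ 𝓑, T B ⊆ B) ∧
    ∀ B ∈ 𝓑, ∀ B' ∈ 𝓑, B ≠ B' → ∃ w ∈ T B ∪ T B', w ∈ B ∪ B' ∧ w ∉ B ∩ B'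

/-- The size of a teaching map for `𝓑`: the largest number of examples it presents for a
concept of `𝓑`. -/
def teachingSize (𝓑 : Finset (Finset V)) (T : Finset V → Finset V) : ℕ :=
  𝓑.sup fun B => (T B).card

/-- Positive non-clashing teaching maps always exist, so that the infimum in `nctdPos` is an
attained minimum. -/
theorem exists_isPositiveNCTM (𝓑 : Finset (Finset V)) : IsPositiveNCTM 𝓑 fun B => B := by
  refine ⟨fun B _ => Finset.Subset.refl B, fun B _ B' _ hne => ?_⟩
  by_contra hcon
  push Not at hcon
  refine hne (Finset.ext fun w => ⟨fun hw => ?_, fun hw => ?_⟩)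
  · exact (Finset.mem_inter.mp (hcon w (Finset.mem_union_left _ hw)
      (Finset.mem_union_left _ hw))).2
  · exact (Finset.mem_inter.mp (hcon w (Finset.mem_union_right _ hw)
      (Finset.mem_union_right _ hw))).1

/-- The positive non-clashing teaching dimension `NCTD⁺(𝓑)`: the smallest size of a positive
non-clashing teaching map for `𝓑`. -/
noncomputable def nctdPos (𝓑 : Finset (Finset V)) : ℕ :=
  sInf {s | ∃ T, IsPositiveNCTM 𝓑 T ∧ teachingSize 𝓑 T = s}

/-- The closed neighborhood `N[v]`. -/
def closedNbhd [Fintype V] (G : SimpleGraph V) [DecidableRel G.Adj] (v : V) : Finset V :=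
  insert v (G.neighborFinset v)

end Teaching

/-! ## Machines, and decision within a time bound -/

/-- The input letters of all problems below. -/
inductive Letter
  | bar
  | comma
  | semicolon
  | plus
  | minus
  deriving DecidableEq

instance : Fintype Letter where
  elems := {Letter.bar, Letter.comma, Letter.semicolon, Letter.plus, Letter.minus}
  complete l := by cases l <;> decide

/-- The problem "does `P a` hold?", whose instances `a` are written as words `enc a`, is solved by
some (deterministic, multi-tape) Turing machine that takes at most `time a` steps on `enc a`,
then halts and outputs the answer. -/
def SolvableInTime {α : Type} (enc : α → List Letter) (P : α → Prop) (time : α → ℝ) : Prop :=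
  ∃ M : Turing.TM2ComputableAux Letter Bool, ∀ a : α, ∃ (answer : Bool) (t : ℕ),
    (answer = true ↔ P a) ∧ (t : ℝ) ≤ time a ∧
      Nonempty (Turing.TM2OutputsInTime M.tm ((enc a).map M.inputAlphabet.symm)
        (some ((Computability.encodeBool answer).map M.outputAlphabet.symm)) t)

/-- A number, in unary and closed by a comma. -/
def encodeNumber (a : ℕ) : List Letter :=
  List.replicate a Letter.bar ++ [Letter.comma]

/-! ## The Exponential Time Hypothesis -/

/-- A 3-CNF formula over the variables `0, …, n - 1`: a list of clauses, each of them a disjunction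
of three literals. The literal `(i, true)` is the variable `i` and `(i, false)` is its negation.
A clause may repeat literals. -/
structure ThreeCNF where
  /-- the number of variables -/
  n : ℕ
  /-- the clauses -/
  clauses : List (Fin 3 → Fin n × Bool)

namespace ThreeCNF

/-- The number of clauses. -/
def m (φ : ThreeCNF) : ℕ := φ.clauses.length

/-- Some assignment of truth values satisfies every clause. -/
def Satisfiable (φ : ThreeCNF) : Prop :=
  ∃ τ : Fin φ.n → Bool, ∀ C ∈ φ.clauses, ∃ s : Fin 3, τ (C s).1 = (C s).2

/-- A literal: its sign, then its variable. -/
def encodeLiteral {n : ℕ} (l : Fin n × Bool) : List Letter :=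
  (if l.2 then Letter.plus else Letter.minus) :: encodeNumber (l.1 : ℕ)

/-- The number of variables, then the clauses one after the other. -/
def encode (φ : ThreeCNF) : List Letter :=
  encodeNumber φ.n ++
    φ.clauses.flatMap fun C =>
      encodeLiteral (C 0) ++ encodeLiteral (C 1) ++ encodeLiteral (C 2) ++ [Letter.semicolon]

end ThreeCNF

/-- The Exponential Time Hypothesis: 3-SAT with `n` variables and `m` clauses cannot be solved in
time `2 ^ o(n + m)`. -/
def ExponentialTimeHypothesis : Prop :=
  ¬ ∃ g : ℕ → ℝ, g =o[atTop] (fun x : ℕ => (x : ℝ)) ∧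
    SolvableInTime ThreeCNF.encode ThreeCNF.Satisfiable fun φ => (2 : ℝ) ^ g (φ.n + φ.m)

/-! ## The problem N-NCTD⁺ -/

/-- An instance: a graph on the vertices `0, …, n - 1`, given by the list of its edges (each edge
`uv` with `u < v` is listed once, in any order of the edges), a set of closed neighborhoods, given
by a list of vertices that are their centers, and a positive integer `k`. -/
structure NNCTDInstance where
  /-- the number of vertices -/
  n : ℕ
  /-- the edges -/
  edges : List (Fin n × Fin n)
  edges_lt : ∀ e ∈ edges, e.1 < e.2
  edges_nodup : edges.Nodup
  /-- the vertices whose closed neighborhoods make up the concept class -/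
  centers : List (Fin n)
  centers_nodup : centers.Nodup
  /-- the bound on the size of the teaching map -/
  k : ℕ
  k_pos : 0 < k

namespace NNCTDInstance

/-- The graph `G`. -/
def graph (I : NNCTDInstance) : SimpleGraph (Fin I.n) where
  Adj u v := (u, v) ∈ I.edges ∨ (v, u) ∈ I.edges
  symm := ⟨fun _ _ h => h.symm⟩
  loopless := ⟨fun v h => lt_irrefl v (h.elim (I.edges_lt _) (I.edges_lt _))⟩

instance (I : NNCTDInstance) : DecidableRel I.graph.Adj := fun u v =>
  inferInstanceAs (Decidable ((u, v) ∈ I.edges ∨ (v, u) ∈ I.edges))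

/-- The set `𝓑` of closed neighborhoods. -/
def family (I : NNCTDInstance) : Finset (Finset (Fin I.n)) :=
  I.centers.toFinset.image (closedNbhd I.graph)

/-- The question: is `NCTD⁺(𝓑) ≤ k`? -/
def IsYes (I : NNCTDInstance) : Prop := nctdPos I.family ≤ I.k

/-- `|V(G)| + |E(G)|`. -/
def graphSize (I : NNCTDInstance) : ℕ := Fintype.card (Fin I.n) + I.graph.edgeFinset.card

/-- The number of vertices, the edges, the centers, and `k`. -/
def encode (I : NNCTDInstance) : List Letter :=
  encodeNumber I.n ++ [Letter.semicolon] ++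
    (I.edges.flatMap fun e : Fin I.n × Fin I.n =>
      encodeNumber (e.1 : ℕ) ++ encodeNumber (e.2 : ℕ)) ++ [Letter.semicolon] ++
    (I.centers.flatMap fun v : Fin I.n => encodeNumber (v : ℕ)) ++ [Letter.semicolon] ++
    encodeNumber I.k

end NNCTDInstance

/-! ## Stack programs and their compilation to multi-stack machines -/

/-! A reduction from 3-SAT of linear size with `k = 1` suffices: `f k` is then the constant `f 1`,
so a solver with exponent o(f(k)(|V| + |E|)) would decide 3-SAT in time 2^o(n+m).

With `k = 1` every concept is taught by at most one vertex. For a variable x, N[keeper x] is N[var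
x] without the two values of x, so N[var x] has to be taught by a value; this defines an assignment.
For a clause j, the sets N[lit j s] cover N[cls j], so no single vertex of N[cls j] separates it
from all three literals. Hence some N[lit j s] is taught by a vertex outside N[cls j]: its link, or
the value that falsifies the literal. Both lie in N[var x] for the variable x of the literal, so the
value that teaches N[var x] must avoid N[lit j s], which means that it makes the literal true.
Conversely, a satisfying assignment gives a teaching map of size 1 (`toNNCTD_isYes`). The graph has
at most 22(n + m) vertices and edges together (`graphSize_toNNCTD_le`).

Time is measured on Turing machines, so the reduction is written as a stack program
(`runs_reductionProgram`), which is compiled and composed with the assumed solver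
(`compose_outputs`). The time of the reduction and the polynomial factor are absorbed into 2^o(n+m)
by `isLittleO_logb_polynomial`. Since g need not be monotone, `exists_isLittleO_bound` replaces it
by a bound in terms of n + m alone. -/

/-- Structured programs over finitely many stacks that all have the same alphabet `A`. -/
inductive StackProgram (P A : Type) : Type
  | skip : StackProgram P A
  | push (p : P) (a : A) : StackProgram P A
  | seq (c d : StackProgram P A) : StackProgram P A
  /-- Pop the top of a stack and continue according to it. -/
  | pop (p : P) (f : Option A → StackProgram P A) : StackProgram P A
  /-- Pop the top of a stack, and run the body and repeat as long as the top satisfies `b`. -/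
  | loop (p : P) (b : Option A → Bool) (f : Option A → StackProgram P A) : StackProgram P A

namespace StackProgram

variable {P A : Type} [DecidableEq P]

/-- `Runs c S S' t`: started with stacks `S`, the program `c` ends with stacks `S'` after at most
`t` steps. -/
inductive Runs : StackProgram P A → (P → List A) → (P → List A) → ℕ → Prop
  | skip (S) : Runs skip S S 1
  | push (p a S) : Runs (push p a) S (Function.update S p (a :: S p)) 1
  | seq {c d S S' S'' t t'} : Runs c S S' t → Runs d S' S'' t' → Runs (seq c d) S S'' (t + t')
  | pop {p f S S' t} : Runs (f (S p).head?) (Function.update S p (S p).tail) S' t →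
      Runs (pop p f) S S' (t + 1)
  | loop_exit {p b f S} : b (S p).head? = false →
      Runs (loop p b f) S (Function.update S p (S p).tail) 1
  | loop_step {p b f S S' S'' t t'} : b (S p).head? = true →
      Runs (f (S p).head?) (Function.update S p (S p).tail) S' t →
      Runs (loop p b f) S' S'' t' → Runs (loop p b f) S S'' (t + t' + 1)
  | mono {c S S' t t'} : Runs c S S' t → t ≤ t' → Runs c S S' t'

/-- The labels of the compiled program. -/
def Label : StackProgram P A → Type
  | skip => Unit
  | push _ _ => Unit
  | seq c d => Label c ⊕ Label d
  | pop _ f => Unit ⊕ Σ a, Label (f a)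
  | loop _ _ f => Unit ⊕ Σ a, Label (f a)

/-- There are finitely many labels. -/
noncomputable instance labelFintype [Fintype A] : (c : StackProgram P A) → Fintype (Label c)
  | skip => inferInstanceAs (Fintype Unit)
  | push _ _ => inferInstanceAs (Fintype Unit)
  | seq c d =>
    letI := labelFintype c
    letI := labelFintype d
    inferInstanceAs (Fintype (Label c ⊕ Label d))
  | pop _ f =>
    letI := fun a => labelFintype (f a)
    inferInstanceAs (Fintype (Unit ⊕ Σ a, Label (f a)))
  | loop _ _ f =>
    letI := fun a => labelFintype (f a)
    inferInstanceAs (Fintype (Unit ⊕ Σ a, Label (f a)))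

/-- The label at which the compiled program starts. -/
def entry : (c : StackProgram P A) → Label c
  | skip => ()
  | push _ _ => ()
  | seq c _ => Sum.inl (entry c)
  | pop _ _ => Sum.inl ()
  | loop _ _ _ => Sum.inl ()

/-! ### Compilation of stack programs, and simulation on extended stacks. -/

section Compile

variable {K : Type} {Γ : K → Type} {Λ σ : Type}

/-- The alphabets of the stacks of a machine with the additional stacks `P`. -/
abbrev ExtAlphabet (P A : Type) (Γ : K → Type) : K ⊕ P → Type := Sum.elim Γ fun _ => A

/-- The stacks of a machine together with the additional stacks. -/
def extStacks (S₀ : ∀ k, List (Γ k)) (S : P → List A) : ∀ k, List (ExtAlphabet P A Γ k)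
  | Sum.inl k => S₀ k
  | Sum.inr p => S p

/-- The statements of the compiled program, whose labels are embedded by `e` and that continues
at the label `exit`. The last popped letter is kept in the second component of the state. -/
def compile : (c : StackProgram P A) → (Label c → Λ) → Λ → Label c →
    Turing.TM2.Stmt (ExtAlphabet P A Γ) Λ (σ × Option A)
  | skip, _, exit, _ => .goto fun _ => exit
  | push p a, _, exit, _ => .push (Sum.inr p) (fun _ => a) (.goto fun _ => exit)
  | seq c d, e, exit, l => match l with
    | Sum.inl l => compile c (fun l => e (Sum.inl l)) (e (Sum.inr (entry d))) l
    | Sum.inr l => compile d (fun l => e (Sum.inr l)) exit l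
  | pop p f, e, exit, l => match l with
    | Sum.inl _ => .pop (Sum.inr p) (fun v a => (v.1, a))
        (.goto fun v => e (Sum.inr ⟨v.2, entry (f v.2)⟩))
    | Sum.inr ⟨a, l⟩ => compile (f a) (fun l => e (Sum.inr ⟨a, l⟩)) exit l
  | loop p b f, e, exit, l => match l with
    | Sum.inl _ => .pop (Sum.inr p) (fun v a => (v.1, a))
        (.branch (fun v => b v.2) (.goto fun v => e (Sum.inr ⟨v.2, entry (f v.2)⟩))
          (.goto fun _ => exit))
    | Sum.inr ⟨a, l⟩ => compile (f a) (fun l => e (Sum.inr ⟨a, l⟩)) (e (Sum.inl ())) l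

variable [DecidableEq K]

theorem update_extStacks_inl (S₀ : ∀ k, List (Γ k)) (S : P → List A) (k : K)
    (x : List (Γ k)) :
    Function.update (extStacks S₀ S) (Sum.inl k) x = extStacks (Function.update S₀ k x) S := by
  funext k'
  rcases k' with k' | p
  · by_cases h : k' = k
    · subst h
      exact (Function.update_self _ _ _).trans (Function.update_self (f := S₀) k' x).symm
    · have h' : Function.update S₀ k x k' = S₀ k' := Function.update_of_ne h x S₀
      exact (Function.update_of_ne (by simpa using h) _ _).trans h'.symm
  · exact Function.update_of_ne (by simp) _ _

theorem update_extStacks_inr (S₀ : ∀ k, List (Γ k)) (S : P → List A) (p : P) (x : List A) :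
    Function.update (extStacks S₀ S) (Sum.inr p) x = extStacks S₀ (Function.update S p x) := by
  funext k'
  rcases k' with k' | p'
  · exact Function.update_of_ne (by simp) _ _
  · by_cases h : p' = p
    · subst h
      exact (Function.update_self _ _ _).trans (Function.update_self (f := S) p' x).symm
    · have h' : Function.update S p x p' = S p' := Function.update_of_ne h x S
      exact (Function.update_of_ne (by simpa using h) _ _).trans h'.symm

/-- `c'` is reached from `c` in at most `t` steps. -/
def ReachesIn {C : Type} (f : C → Option C) (c c' : C) (t : ℕ) : Prop :=
  Nonempty (StateTransition.EvalsToInTime f c (some c') t)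

theorem ReachesIn.mono {C : Type} {f : C → Option C} {c c' : C} {t t' : ℕ}
    (h : ReachesIn f c c' t) (ht : t ≤ t') : ReachesIn f c c' t' :=
  ⟨⟨h.some.toEvalsTo, h.some.steps_le_m.trans ht⟩⟩

theorem ReachesIn.trans {C : Type} {f : C → Option C} {c c' c'' : C} {t t' : ℕ}
    (h : ReachesIn f c c' t) (h' : ReachesIn f c' c'' t') : ReachesIn f c c'' (t + t') :=
  ReachesIn.mono ⟨h.some.trans f _ _ _ _ _ h'.some⟩ (add_comm _ _).le

theorem ReachesIn.single {C : Type} {f : C → Option C} {c c' : C} (h : f c = some c') :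
    ReachesIn f c c' 1 :=
  ⟨⟨⟨1, by simpa [flip] using h⟩, le_rfl⟩⟩

/-- A compiled program does what the program says. -/
theorem Runs.reachesIn {m : Λ → Turing.TM2.Stmt (ExtAlphabet P A Γ) Λ (σ × Option A)}
    {c : StackProgram P A} {S S' : P → List A} {t : ℕ} (h : Runs c S S' t)
    (e : Label c → Λ) (exit : Λ) (hm : ∀ l, m (e l) = compile c e exit l)
    (S₀ : ∀ k, List (Γ k)) (v : σ) (r : Option A) :
    ∃ r', ReachesIn (Turing.TM2.step m) ⟨some (e (entry c)), (v, r), extStacks S₀ S⟩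
      ⟨some exit, (v, r'), extStacks S₀ S'⟩ t := by
  -- `exit` varies because the first half of a `seq` exits into the second and a loop body exits
  -- back to its loop; `r` varies because every pop overwrites it.
  induction h generalizing exit r with
  | skip S =>
    exact ⟨r, .single (congrArg (fun q => some (Turing.TM2.stepAux q _ _)) (hm _))⟩
  | push p a S =>
    refine ⟨r, .single ((congrArg (fun q => some (Turing.TM2.stepAux q _ _)) (hm _)).trans ?_)⟩
    exact congrArg (fun T => some (Turing.TM2.Cfg.mk _ _ T)) (update_extStacks_inr S₀ S p _)
  | @seq c d S S' S'' t t' _ _ ih₁ ih₂ =>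
    obtain ⟨r₁, h₁⟩ := ih₁ (fun l => e (Sum.inl l)) (e (Sum.inr (entry d))) (fun l => hm _) r
    obtain ⟨r₂, h₂⟩ := ih₂ (fun l => e (Sum.inr l)) exit (fun l => hm _) r₁
    exact ⟨r₂, h₁.trans h₂⟩
  | @pop p f S S' t _ ih =>
    obtain ⟨r', h'⟩ := ih (fun l => e (Sum.inr ⟨_, l⟩)) exit (fun l => hm _) (S p).head?
    refine ⟨r', ReachesIn.mono ((ReachesIn.single ?_).trans h') (add_comm _ _).le⟩
    refine (congrArg (fun q => some (Turing.TM2.stepAux q _ _)) (hm _)).trans ?_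
    exact congrArg (fun T => some (Turing.TM2.Cfg.mk _ _ T)) (update_extStacks_inr S₀ S p _)
  | @loop_exit p b f S hb =>
    refine ⟨(S p).head?, .single ?_⟩
    refine (congrArg (fun q => some (Turing.TM2.stepAux q _ _)) (hm _)).trans ?_
    refine (congrArg (fun b' => some (cond b' _ _)) hb).trans ?_
    exact congrArg (fun T => some (Turing.TM2.Cfg.mk _ _ T)) (update_extStacks_inr S₀ S p _)
  | @loop_step p b f S S' S'' t t' hb _ _ ih₁ ih₂ =>
    obtain ⟨r₁, h₁⟩ := ih₁ (fun l => e (Sum.inr ⟨_, l⟩)) (e (Sum.inl ())) (fun l => hm _)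
      (S p).head?
    obtain ⟨r₂, h₂⟩ := ih₂ e exit hm r₁
    refine ⟨r₂, ReachesIn.mono (((ReachesIn.single ?_).trans h₁).trans h₂) (by omega)⟩
    refine (congrArg (fun q => some (Turing.TM2.stepAux q _ _)) (hm _)).trans ?_
    refine (congrArg (fun b' => some (cond b' _ _)) hb).trans ?_
    exact congrArg (fun T => some (Turing.TM2.Cfg.mk _ _ T)) (update_extStacks_inr S₀ S p _)
  | mono _ ht ih =>
    obtain ⟨r', h'⟩ := ih e exit hm r
    exact ⟨r', h'.mono ht⟩

/-- A statement of a machine, run on the extended stacks. -/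
def extStmt {Λ' : Type} (e : Λ → Λ') : Turing.TM2.Stmt Γ Λ σ →
    Turing.TM2.Stmt (ExtAlphabet P A Γ) Λ' (σ × Option A)
  | .push k f q => .push (Sum.inl k) (fun v => f v.1) (extStmt e q)
  | .peek k f q => .peek (Sum.inl k) (fun v a => (f v.1 a, v.2)) (extStmt e q)
  | .pop k f q => .pop (Sum.inl k) (fun v a => (f v.1 a, v.2)) (extStmt e q)
  | .load f q => .load (fun v => (f v.1, v.2)) (extStmt e q)
  | .branch f q q' => .branch (fun v => f v.1) (extStmt e q) (extStmt e q')
  | .goto f => .goto fun v => e (f v.1)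
  | .halt => .halt

/-- A configuration of a machine, with additional stacks. -/
def extCfg {Λ' : Type} (e : Λ → Λ') (r : Option A) (S : P → List A) (c : Turing.TM2.Cfg Γ Λ σ) :
    Turing.TM2.Cfg (ExtAlphabet P A Γ) Λ' (σ × Option A) :=
  ⟨c.l.map e, (c.var, r), extStacks c.stk S⟩

/-- The embedded statement touches neither the additional stacks nor the stored letter, so the
simulation is exact, one step for one step. -/
theorem stepAux_extStmt {Λ' : Type} (e : Λ → Λ') (r : Option A) (S : P → List A)
    (q : Turing.TM2.Stmt Γ Λ σ) (v : σ) (S₀ : ∀ k, List (Γ k)) :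
    Turing.TM2.stepAux (extStmt e q) (v, r) (extStacks S₀ S) =
      extCfg e r S (Turing.TM2.stepAux q v S₀) := by
  induction q generalizing v S₀ with
  | push k f q ih =>
    exact (congrArg (Turing.TM2.stepAux _ _) (update_extStacks_inl S₀ S k _)).trans (ih _ _)
  | peek k f q ih => exact ih _ _
  | pop k f q ih =>
    exact (congrArg (Turing.TM2.stepAux _ _) (update_extStacks_inl S₀ S k _)).trans (ih _ _)
  | load f q ih => exact ih _ _
  | branch f q q' ih ih' =>
    simp only [extStmt, Turing.TM2.stepAux]
    cases f v
    · exact ih' _ _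
    · exact ih _ _
  | goto f => rfl
  | halt => rfl

theorem step_extCfg {Λ' : Type} (e : Λ → Λ') (r : Option A) (S : P → List A)
    {m : Λ → Turing.TM2.Stmt Γ Λ σ}
    {m' : Λ' → Turing.TM2.Stmt (ExtAlphabet P A Γ) Λ' (σ × Option A)}
    (hm : ∀ l, m' (e l) = extStmt e (m l)) (c : Turing.TM2.Cfg Γ Λ σ) :
    Turing.TM2.step m' (extCfg e r S c) = (Turing.TM2.step m c).map (extCfg e r S) := by
  obtain ⟨_ | l, v, S₀⟩ := c
  · rfl
  · simp only [extCfg, Option.map_some, Turing.TM2.step, hm, stepAux_extStmt]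

theorem reachesIn_map {C D : Type} {f : C → Option C} {g : D → Option D} (φ : C → D)
    (h : ∀ c, g (φ c) = (f c).map φ) {c c' : C} {t : ℕ} (hr : ReachesIn f c c' t) :
    ReachesIn g (φ c) (φ c') t := by
  obtain ⟨⟨⟨n, hn⟩, ht⟩⟩ := hr
  refine ⟨⟨⟨n, ?_⟩, ht⟩⟩
  -- Runs iterate a map on `Option C`, so the intertwining is proved from an arbitrary option,
  -- `none` included.
  have key : ∀ (n : ℕ) (o : Option C),
      (flip Bind.bind g)^[n] (o.map φ) = ((flip Bind.bind f)^[n] o).map φ := by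
    intro n
    induction n with
    | zero => intro o; rfl
    | succ n ih =>
      intro o
      rw [Function.iterate_succ_apply, Function.iterate_succ_apply, ← ih]
      congr 1
      cases o with
      | none => rfl
      | some c => exact h c
  have := key n (some c)
  rw [show (flip Bind.bind f)^[n] (some c) = some c' from hn] at this
  exact this

end Compile

/-- The stacks with the word `w` on `p` and nothing elsewhere. -/
def only (p : P) (w : List A) : P → List A := Function.update (fun _ => []) p w

/-! ### Composition of a program with a machine. -/

section Compose

variable [Fintype P] [Fintype A] [Inhabited A] {B : Type}

/-- The labels of the machine that runs `c`, moves the word on `out` (reversing it) to the input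
stack of `M`, and runs `M`. -/
abbrev ComposeLabel (c : StackProgram P A) (M : Turing.TM2ComputableAux A B) : Type :=
  M.tm.Λ ⊕ (Unit ⊕ Label c)

/-- The statements of the composed machine. -/
def composeStmt (c : StackProgram P A) (out : P) (M : Turing.TM2ComputableAux A B) :
    ComposeLabel c M →
      Turing.TM2.Stmt (ExtAlphabet P A M.tm.Γ) (ComposeLabel c M) (M.tm.σ × Option A)
  | Sum.inl l => extStmt Sum.inl (M.tm.m l)
  | Sum.inr (Sum.inl _) => .pop (Sum.inr out) (fun v a => (v.1, a))
      (.branch (fun v => v.2.isSome)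
        (.push (Sum.inl M.tm.k₀) (fun v => M.inputAlphabet.symm (v.2.getD default))
          (.goto fun _ => Sum.inr (Sum.inl ())))
        (.goto fun _ => Sum.inl M.tm.main))
  | Sum.inr (Sum.inr l) =>
      compile c (fun l => Sum.inr (Sum.inr l)) (Sum.inr (Sum.inl ())) l

/-- The composition of a program with a machine. -/
noncomputable def compose (c : StackProgram P A) (inp out : P) (M : Turing.TM2ComputableAux A B) :
    Turing.TM2ComputableAux A B where
  tm :=
    letI := M.tm.kFin
    letI := M.tm.ΛFin
    letI := M.tm.σFin
    letI := labelFintype c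
    { K := M.tm.K ⊕ P
      k₀ := Sum.inr inp
      k₁ := Sum.inl M.tm.k₁
      Γ := ExtAlphabet P A M.tm.Γ
      Λ := ComposeLabel c M
      main := Sum.inr (Sum.inr (entry c))
      σ := M.tm.σ × Option A
      initialState := (M.tm.initialState, none)
      Γk₀Fin := inferInstanceAs (Fintype A)
      m := composeStmt c out M }
  inputAlphabet := Equiv.refl A
  outputAlphabet := M.outputAlphabet

-- Induction on the letters still to be moved, with `w` those already on the input stack of `M`.
-- Each letter takes one step; the extra step finds `out` empty and jumps to the start of `M`.
omit [Fintype P] [Fintype A] in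
theorem transfer_reachesIn (c : StackProgram P A) (out : P) (M : Turing.TM2ComputableAux A B)
    (u w : List A) (r : Option A) :
    ReachesIn (Turing.TM2.step (composeStmt c out M))
      ⟨some (Sum.inr (Sum.inl ())), (M.tm.initialState, r),
        extStacks (Turing.initList M.tm (w.map M.inputAlphabet.symm)).stk (only out u)⟩
      (extCfg Sum.inl none (fun _ => [])
        (Turing.initList M.tm ((u.reverse ++ w).map M.inputAlphabet.symm)))
      (u.length + 1) := by
  induction u generalizing w r with
  | nil =>
    refine .single ?_
    have h₁ : only out ([] : List A) = fun _ => [] := Function.update_eq_self _ _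
    rw [h₁]
    exact congrArg (fun T => some (Turing.TM2.Cfg.mk _ _ T))
      ((update_extStacks_inr _ _ out _).trans (congrArg _ (Function.update_eq_self _ _)))
  | cons a u ih =>
    have hstep : Turing.TM2.step (composeStmt c out M)
      ⟨some (Sum.inr (Sum.inl ())), (M.tm.initialState, r),
        extStacks (Turing.initList M.tm (w.map M.inputAlphabet.symm)).stk (only out (a :: u))⟩ =
      some ⟨some (Sum.inr (Sum.inl ())), (M.tm.initialState, some a),
        extStacks (Turing.initList M.tm ((a :: w).map M.inputAlphabet.symm)).stk
          (only out u)⟩ := by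
      have h₁ : only out (a :: u) out = a :: u := Function.update_self _ _ _
      have h₂ : Function.update (only out (a :: u)) out u = only out u :=
        Function.update_idem _ _ _
      generalize only out (a :: u) = S at h₁ h₂ ⊢
      have h₃ : ∀ T : ∀ k, List (ExtAlphabet P A M.tm.Γ k), T (Sum.inr out) = S out →
          Turing.TM2.step (composeStmt c out M)
            ⟨some (Sum.inr (Sum.inl ())), (M.tm.initialState, r), T⟩ =
          some ⟨some (Sum.inr (Sum.inl ())), (M.tm.initialState, some a),
            Function.update (Function.update T (Sum.inr out) (T (Sum.inr out)).tail)
              (Sum.inl M.tm.k₀) (M.inputAlphabet.symm a ::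
                Function.update T (Sum.inr out) (T (Sum.inr out)).tail (Sum.inl M.tm.k₀))⟩ := by
        intro T hT
        have h₄ : (T (Sum.inr out)).head? = some a :=
          (congrArg List.head? (hT.trans h₁) :)
        exact congrArg (fun o : Option A => some (cond o.isSome
          (Turing.TM2.Cfg.mk (some (Sum.inr (Sum.inl ()))) (M.tm.initialState, o)
            (Function.update (Function.update T (Sum.inr out) (T (Sum.inr out)).tail)
              (Sum.inl M.tm.k₀) (M.inputAlphabet.symm (o.getD default) ::
                Function.update T (Sum.inr out) (T (Sum.inr out)).tail (Sum.inl M.tm.k₀))))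
          (Turing.TM2.Cfg.mk (some (Sum.inl M.tm.main)) (M.tm.initialState, o)
            (Function.update T (Sum.inr out) (T (Sum.inr out)).tail)))) h₄
      refine (h₃ _ rfl).trans (congrArg (fun T => some (Turing.TM2.Cfg.mk _ _ T)) ?_)
      have h₅ : Function.update S out (S out).tail = only out u := by rw [h₁, ← h₂]; rfl
      refine Eq.trans (congrArg (fun T : ∀ k, List (ExtAlphabet P A M.tm.Γ k) =>
        Function.update T (Sum.inl M.tm.k₀) (M.inputAlphabet.symm a :: T (Sum.inl M.tm.k₀)))
        ((update_extStacks_inr _ _ out _).trans (congrArg _ h₅))) ?_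
      refine (update_extStacks_inl _ _ _ _).trans (congrArg (fun T => extStacks T _) ?_)
      funext k
      by_cases hk : k = M.tm.k₀
      · subst hk
        refine (Function.update_self _ _ _).trans ?_
        simp [extStacks, Turing.initList]
      · refine (Function.update_of_ne hk _ _).trans ?_
        simp [Turing.initList, hk]
    have := (ReachesIn.single hstep).trans (ih (a :: w) (some a))
    refine ReachesIn.mono ?_ (le_of_eq (by simp; omega) : 1 + (u.length + 1) ≤ _)
    simpa using this

theorem initList_stk_input (tm : Turing.FinTM2) (w : List (tm.Γ tm.k₀)) :
    (Turing.initList tm w).stk tm.k₀ = w := by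
  simp [Turing.initList]

theorem haltList_stk_output (tm : Turing.FinTM2) (w : List (tm.Γ tm.k₁)) :
    (Turing.haltList tm w).stk tm.k₁ = w := by
  simp [Turing.haltList]

/-- The composition of a program that turns `w` into the reversal of `u` with a machine `M` does on
`w` what `M` does on `u`. -/
theorem compose_outputs {c : StackProgram P A} {inp out : P} {M : Turing.TM2ComputableAux A B}
    {w u : List A} {b : List B} {t s : ℕ} (h : Runs c (only inp w) (only out u.reverse) t)
    (hM : Nonempty (Turing.TM2OutputsInTime M.tm (u.map M.inputAlphabet.symm)
      (some (b.map M.outputAlphabet.symm)) s)) :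
    Nonempty (Turing.TM2OutputsInTime (compose c inp out M).tm
      (w.map (compose c inp out M).inputAlphabet.symm)
      (some (b.map (compose c inp out M).outputAlphabet.symm)) (t + (u.length + 1) + s)) := by
  obtain ⟨r, h₁⟩ := h.reachesIn (m := composeStmt c out M) (fun l => Sum.inr (Sum.inr l))
    (Sum.inr (Sum.inl ())) (fun l => rfl) (fun _ => []) M.tm.initialState none
  have h₂ := transfer_reachesIn c out M u.reverse [] r
  have h₃ : ReachesIn (Turing.TM2.step M.tm.m) (Turing.initList M.tm (u.map M.inputAlphabet.symm))
    (Turing.haltList M.tm (b.map M.outputAlphabet.symm)) s := hM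
  have h₄ := reachesIn_map (extCfg (P := P) (A := A) Sum.inl none fun _ => [])
    (fun c' => step_extCfg (Λ' := ComposeLabel c M) Sum.inl none (fun _ => [])
      (m := M.tm.m) (m' := composeStmt c out M) (fun _ => rfl) c') h₃
  have e₁ : (Turing.initList M.tm (([] : List A).map M.inputAlphabet.symm)).stk = fun _ => [] := by
    funext k
    simp only [Turing.initList, List.map_nil]
    split_ifs with hk
    · subst hk; rfl
    · rfl
  rw [e₁, List.reverse_reverse, List.append_nil, List.length_reverse] at h₂
  have h₅ := (h₁.trans h₂).trans h₄
  have e₂ : (⟨some (Sum.inr (Sum.inr (entry c))), (M.tm.initialState, none),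
      extStacks (fun _ => []) (only inp w)⟩ :
        Turing.TM2.Cfg (ExtAlphabet P A M.tm.Γ) (ComposeLabel c M) (M.tm.σ × Option A)) =
      Turing.initList (compose c inp out M).tm
        (w.map (compose c inp out M).inputAlphabet.symm) := by
    refine Turing.TM2.Cfg.mk.injEq .. |>.mpr ⟨rfl, rfl, ?_⟩
    funext k
    rcases k with k | p
    · rfl
    · by_cases hp : p = inp
      · subst hp
        refine (Function.update_self _ _ _ : only p w p = w).trans ?_
        exact (List.map_id w).symm.trans
          (initList_stk_input (compose c p out M).tm (List.map id w)).symm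
      · refine (Function.update_of_ne hp _ _ : only inp w p = []).trans ?_
        simp [compose, hp]
  have e₃ : extCfg (Λ' := ComposeLabel c M) Sum.inl none (fun _ => [])
      (Turing.haltList M.tm (b.map M.outputAlphabet.symm)) =
      Turing.haltList (compose c inp out M).tm
        (b.map (compose c inp out M).outputAlphabet.symm) := by
    refine Turing.TM2.Cfg.mk.injEq .. |>.mpr ⟨rfl, rfl, ?_⟩
    funext k
    rcases k with k | p
    · by_cases hp : k = M.tm.k₁
      · subst hp
        exact (haltList_stk_output M.tm _).trans
          (haltList_stk_output (compose c inp out M).tm _).symm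
      · simp [Turing.haltList, compose, extStacks, hp]
    · rfl
  rw [e₂, e₃] at h₅
  exact h₅

end Compose

end StackProgram

/-! ## The reduction from 3-SAT -/

namespace ThreeCNF

/-- The clause with index `j`. -/
def clause (φ : ThreeCNF) (j : Fin φ.m) : Fin 3 → Fin φ.n × Bool := φ.clauses.get (j.cast rfl)

/-- The vertices of the graph of a formula. -/
inductive Vertex (φ : ThreeCNF) : Type
  /-- the variable `x` -/
  | var (x : Fin φ.n)
  /-- keeps the variable `x` from being taught by anything but its values -/
  | keeper (x : Fin φ.n)
  /-- the value `b` of the variable `x` -/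
  | val (x : Fin φ.n) (b : Bool)
  /-- a clause -/
  | cls (j : Fin φ.m)
  /-- a literal in a clause -/
  | lit (j : Fin φ.m) (s : Fin 3)
  /-- links a literal in a clause to its variable -/
  | link (j : Fin φ.m) (s : Fin 3)

variable (φ : ThreeCNF)

/-- The number of vertices of the graph. -/
def order : ℕ := 4 * φ.n + 7 * φ.m

namespace Vertex

variable {φ}

/-- The number of a vertex. -/
def toNat : Vertex φ → ℕ
  -- Blocks of four numbers for the variables, then blocks of seven for the clauses: the clause at
  -- offset 0, its literals at 1, 3, 5, its links at 2, 4, 6. In this numbering every listed edge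
  -- goes from a smaller to a larger number.
  | var x => 4 * x
  | keeper x => 4 * x + 1
  | val x b => 4 * x + (if b then 2 else 3)
  | cls j => 4 * φ.n + 7 * j
  | lit j s => 4 * φ.n + 7 * j + (1 + 2 * s)
  | link j s => 4 * φ.n + 7 * j + (2 + 2 * s)

theorem toNat_lt (v : Vertex φ) : v.toNat < φ.order := by
  rcases v with x | x | ⟨x, _ | _⟩ | j | ⟨j, s⟩ | ⟨j, s⟩ <;> simp only [toNat, order] <;>
    first
      | (have := x.isLt; simp; omega)
      | (have := j.isLt; omega)

theorem toNat_injective : Function.Injective (toNat (φ := φ)) := by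
  intro v w h
  rcases v with x | x | ⟨x, _ | _⟩ | j | ⟨j, s⟩ | ⟨j, s⟩ <;>
  rcases w with x' | x' | ⟨x', _ | _⟩ | j' | ⟨j', s'⟩ | ⟨j', s'⟩ <;>
  simp only [toNat, Bool.false_eq_true, if_true, if_false] at h <;>
  simp only [var.injEq, keeper.injEq, val.injEq, cls.injEq, lit.injEq, link.injEq, Fin.ext_iff,
    and_true, reduceCtorEq] <;> omega

/-- The vertex as an element of `Fin`. -/
def toFin (v : Vertex φ) : Fin φ.order := ⟨v.toNat, v.toNat_lt⟩

theorem toFin_injective : Function.Injective (toFin (φ := φ)) := fun _ _ h =>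
  toNat_injective (congrArg Fin.val h)

end Vertex

open Vertex

/-- The edges at a variable. -/
def varEdges (x : Fin φ.n) : List (Vertex φ × Vertex φ) :=
  [(var x, keeper x), (var x, val x true), (var x, val x false)]

/-- The edges at a literal `l` in position `s` of the clause `j`. -/
def litEdges (j : Fin φ.m) (s : Fin 3) (l : Fin φ.n × Bool) : List (Vertex φ × Vertex φ) :=
  -- The literal is joined to the value that falsifies it. The link is joined to the keeper as well,
  -- so that the values remain the only difference between N[var x] and N[keeper x].
  [(var l.1, link j s), (keeper l.1, link j s), (val l.1 (!l.2), lit j s), (cls j, lit j s),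
    (lit j s, link j s)]

/-- All edges. -/
def edgeList : List (Vertex φ × Vertex φ) :=
  (List.finRange φ.n).flatMap φ.varEdges ++
    (List.finRange φ.m).flatMap fun j =>
      φ.litEdges j 0 (φ.clause j 0) ++ φ.litEdges j 1 (φ.clause j 1) ++
        φ.litEdges j 2 (φ.clause j 2)

/-- The centers of the concepts. -/
def centerList : List (Vertex φ) :=
  (List.finRange φ.n).flatMap (fun x => [var x, keeper x]) ++
    (List.finRange φ.m).flatMap fun j => [cls j, lit j 0, lit j 1, lit j 2]

theorem mem_edgeList {e : Vertex φ × Vertex φ} : e ∈ φ.edgeList ↔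
    (∃ x, e ∈ φ.varEdges x) ∨ ∃ j s, e ∈ φ.litEdges j s (φ.clause j s) := by
  simp [edgeList, Fin.exists_fin_succ]

theorem mem_centerList {v : Vertex φ} : v ∈ φ.centerList ↔
    (∃ x, v = var x ∨ v = keeper x) ∨ ∃ j, v = cls j ∨ ∃ s, v = lit j s := by
  simp [centerList, Fin.exists_fin_succ]

theorem edgeList_lt {e : Vertex φ × Vertex φ} (he : e ∈ φ.edgeList) : e.1.toNat < e.2.toNat := by
  rw [mem_edgeList] at he
  rcases he with ⟨x, h⟩ | ⟨j, s, h⟩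
  · simp only [varEdges, List.mem_cons, List.not_mem_nil, or_false] at h
    rcases h with rfl | rfl | rfl <;> simp [Vertex.toNat]
  · have := (φ.clause j s).1.isLt
    simp only [litEdges, List.mem_cons, List.not_mem_nil, or_false] at h
    rcases h with rfl | rfl | rfl | rfl | rfl <;> simp only [Vertex.toNat]
    · omega
    · omega
    · split_ifs <;> omega
    · omega
    · omega

/-- Every edge of a clause gadget has an endpoint that carries `j` and `s`, so repeated literals or
clauses produce no repeated edge. -/
theorem edgeList_nodup : φ.edgeList.Nodup := by
  refine List.nodup_append'.2 ⟨?_, ?_, ?_⟩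
  · refine List.nodup_flatMap.2 ⟨fun x _ => by simp [varEdges], ?_⟩
    refine (List.nodup_finRange _).imp fun {x y} hxy => ?_
    simp [Function.onFun, varEdges, hxy.symm]
  · refine List.nodup_flatMap.2 ⟨fun j _ => by simp [litEdges], ?_⟩
    refine (List.nodup_finRange _).imp fun {x y} hxy => ?_
    simp [Function.onFun, litEdges, hxy.symm]
  · intro e h₁ h₂
    simp only [List.mem_flatMap, varEdges, List.mem_cons, List.not_mem_nil, or_false] at h₁
    obtain ⟨x, -, rfl | rfl | rfl⟩ := h₁ <;> simp [litEdges] at h₂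

theorem centerList_nodup : φ.centerList.Nodup := by
  refine List.nodup_append'.2 ⟨?_, ?_, ?_⟩
  · refine List.nodup_flatMap.2 ⟨fun x _ => by simp, ?_⟩
    refine (List.nodup_finRange _).imp fun {x y} hxy => ?_
    simp [Function.onFun, hxy.symm]
  · refine List.nodup_flatMap.2 ⟨fun j _ => by simp, ?_⟩
    refine (List.nodup_finRange _).imp fun {x y} hxy => ?_
    simp [Function.onFun, hxy.symm]
  · intro e h₁ h₂
    simp only [List.mem_flatMap, List.mem_cons, List.not_mem_nil, or_false] at h₁
    obtain ⟨x, -, rfl | rfl⟩ := h₁ <;> simp at h₂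

/-- The instance of N-NCTD⁺ for the formula `φ`. -/
abbrev toNNCTD : NNCTDInstance where
  n := φ.order
  edges := φ.edgeList.map (Prod.map toFin toFin)
  edges_lt := by
    intro e he
    obtain ⟨e', he', rfl⟩ := List.mem_map.1 he
    exact φ.edgeList_lt he'
  edges_nodup := φ.edgeList_nodup.map (toFin_injective.prodMap toFin_injective)
  centers := φ.centerList.map toFin
  centers_nodup := φ.centerList_nodup.map toFin_injective
  -- A constant `k` turns the factor `f k` into a constant.
  k := 1
  k_pos := one_pos

/-- The closed neighborhood of a vertex of the graph of `φ`. -/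
def nbhd (v : Vertex φ) : Finset (Fin φ.order) := closedNbhd φ.toNNCTD.graph v.toFin

theorem mem_nbhd {v : Vertex φ} {w : Fin φ.order} : w ∈ φ.nbhd v ↔
    ∃ u : Vertex φ, u.toFin = w ∧ (u = v ∨ (v, u) ∈ φ.edgeList ∨ (u, v) ∈ φ.edgeList) := by
  have hadj : ∀ u u' : Fin φ.order, (u, u') ∈ φ.toNNCTD.edges ↔
      ∃ e ∈ φ.edgeList, e.1.toFin = u ∧ e.2.toFin = u' := by
    intro u u'
    refine List.mem_map.trans (exists_congr fun e => and_congr_right fun _ => ?_)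
    exact Prod.ext_iff
  have h₁ : w ∈ φ.nbhd v ↔ w = v.toFin ∨
      ((v.toFin, w) ∈ φ.toNNCTD.edges ∨ (w, v.toFin) ∈ φ.toNNCTD.edges) := by
    unfold nbhd closedNbhd
    rw [Finset.mem_insert, SimpleGraph.mem_neighborFinset]
    rfl
  rw [h₁, hadj, hadj]
  constructor
  · rintro (rfl | ⟨⟨a, b⟩, he, ha, rfl⟩ | ⟨⟨a, b⟩, he, rfl, hb⟩)
    · exact ⟨v, rfl, Or.inl rfl⟩
    · obtain rfl := toFin_injective ha
      exact ⟨b, rfl, Or.inr (Or.inl he)⟩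
    · obtain rfl := toFin_injective hb
      exact ⟨a, rfl, Or.inr (Or.inr he)⟩
  · rintro ⟨u, rfl, rfl | he | he⟩
    · exact Or.inl rfl
    · exact Or.inr (Or.inl ⟨_, he, rfl, rfl⟩)
    · exact Or.inr (Or.inr ⟨_, he, rfl, rfl⟩)

theorem toFin_mem_nbhd {v u : Vertex φ} : u.toFin ∈ φ.nbhd v ↔
    u = v ∨ (v, u) ∈ φ.edgeList ∨ (u, v) ∈ φ.edgeList := by
  rw [mem_nbhd]
  constructor
  · rintro ⟨u', h, h'⟩
    obtain rfl := toFin_injective h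
    exact h'
  · exact fun h => ⟨u, rfl, h⟩

/-! ### The closed neighborhoods of the four kinds of centers. -/

theorem toFin_mem_nbhd_var {x : Fin φ.n} {u : Vertex φ} : u.toFin ∈ φ.nbhd (var x) ↔
    u = var x ∨ u = keeper x ∨ (∃ b, u = val x b) ∨
      ∃ j s, (φ.clause j s).1 = x ∧ u = link j s := by
  rw [toFin_mem_nbhd, mem_edgeList, mem_edgeList]
  rcases u with y | y | ⟨y, _ | _⟩ | j | ⟨j, s⟩ | ⟨j, s⟩ <;>
    simp only [varEdges, litEdges, List.mem_cons, List.not_mem_nil, or_false, Prod.mk.injEq,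
      var.injEq, keeper.injEq, val.injEq, cls.injEq, lit.injEq, link.injEq, reduceCtorEq, false_and,
      and_false, exists_false, false_or] <;>
    grind

/-- Exactly the values are missing in comparison with N[var x]; this forces a value to teach the
variable. -/
theorem toFin_mem_nbhd_keeper {x : Fin φ.n} {u : Vertex φ} : u.toFin ∈ φ.nbhd (keeper x) ↔
    u = var x ∨ u = keeper x ∨ ∃ j s, (φ.clause j s).1 = x ∧ u = link j s := by
  rw [toFin_mem_nbhd, mem_edgeList, mem_edgeList]
  rcases u with y | y | ⟨y, _ | _⟩ | j | ⟨j, s⟩ | ⟨j, s⟩ <;>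
    simp only [varEdges, litEdges, List.mem_cons, List.not_mem_nil, or_false, Prod.mk.injEq,
      var.injEq, keeper.injEq, val.injEq, cls.injEq, lit.injEq, link.injEq, reduceCtorEq, false_and,
      and_false, exists_false, false_or] <;>
    grind

theorem toFin_mem_nbhd_cls {j : Fin φ.m} {u : Vertex φ} : u.toFin ∈ φ.nbhd (cls j) ↔
    u = cls j ∨ ∃ s, u = lit j s := by
  rw [toFin_mem_nbhd, mem_edgeList, mem_edgeList]
  rcases u with y | y | ⟨y, _ | _⟩ | j | ⟨j, s⟩ | ⟨j, s⟩ <;>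
    simp only [varEdges, litEdges, List.mem_cons, List.not_mem_nil, or_false, Prod.mk.injEq,
      var.injEq, keeper.injEq, val.injEq, cls.injEq, lit.injEq, link.injEq, reduceCtorEq, false_and,
      and_false, exists_false, false_or]
  all_goals grind

theorem toFin_mem_nbhd_lit {j : Fin φ.m} {s : Fin 3} {u : Vertex φ} :
    u.toFin ∈ φ.nbhd (lit j s) ↔
      u = lit j s ∨ u = cls j ∨ u = link j s ∨ u = val (φ.clause j s).1 (!(φ.clause j s).2) := by
  rw [toFin_mem_nbhd, mem_edgeList, mem_edgeList]
  rcases u with y | y | ⟨y, _ | _⟩ | j | ⟨j, s⟩ | ⟨j, s⟩ <;>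
    simp only [varEdges, litEdges, List.mem_cons, List.not_mem_nil, or_false, Prod.mk.injEq,
      var.injEq, keeper.injEq, val.injEq, cls.injEq, lit.injEq, link.injEq, reduceCtorEq, false_and,
      and_false, exists_false, false_or] <;>
    grind

theorem mem_family {B : Finset (Fin φ.order)} :
    B ∈ φ.toNNCTD.family ↔ ∃ v ∈ φ.centerList, φ.nbhd v = B := by
  unfold NNCTDInstance.family
  rw [Finset.mem_image]
  constructor
  · rintro ⟨w, hw, rfl⟩
    obtain ⟨v, hv, rfl⟩ := List.mem_map.1 (List.mem_toFinset.1 hw)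
    exact ⟨v, hv, rfl⟩
  · rintro ⟨v, hv, rfl⟩
    exact ⟨v.toFin, List.mem_toFinset.2 (List.mem_map.2 ⟨v, hv, rfl⟩), rfl⟩

/-! ### Satisfiability is equivalent to a teaching map of size 1. -/

theorem satisfiable_iff : φ.Satisfiable ↔
    ∃ τ : Fin φ.n → Bool, ∀ j, ∃ s, τ (φ.clause j s).1 = (φ.clause j s).2 := by
  refine exists_congr fun τ => ⟨fun h j => h _ (List.get_mem _ _), fun h C hC => ?_⟩
  obtain ⟨j, rfl⟩ := List.mem_iff_get.1 hC
  exact h j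

/-- A variable is taught by its value under `τ`, a keeper by itself, a clause by a true literal `σ
j` in it. A true literal is separated from its variable because the chosen value is not adjacent to
it, a false one because it teaches itself. -/
theorem exists_positiveNCTM_of_satisfiable (h : φ.Satisfiable) :
    ∃ T, IsPositiveNCTM φ.toNNCTD.family T ∧ teachingSize φ.toNNCTD.family T ≤ 1 := by
  classical
  obtain ⟨τ, hτ⟩ := φ.satisfiable_iff.1 h
  choose σ hσ using hτ
  let pick : Vertex φ → Vertex φ
    | var x => val x (τ x)
    | keeper x => keeper x
    | val x b => val x b
    | cls j => lit j (σ j)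
    -- The link lies outside N[cls j], which separates the true literals from the clause. A false
    -- literal differs from `lit j (σ j)`, which therefore separates the clause from it.
    | lit j s => if τ (φ.clause j s).1 = (φ.clause j s).2 then link j s else lit j s
    | link j s => link j s
  have hmem : ∀ v ∈ φ.centerList, (pick v).toFin ∈ φ.nbhd v := by
    intro v hv
    rw [mem_centerList] at hv
    rcases hv with ⟨x, rfl | rfl⟩ | ⟨j, rfl | ⟨s, rfl⟩⟩
    · simp [pick, toFin_mem_nbhd_var]
    · simp [pick, toFin_mem_nbhd_keeper]
    · simp [pick, toFin_mem_nbhd_cls]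
    · rw [toFin_mem_nbhd_lit]
      simp only [pick]
      split_ifs <;> simp
  have hpair : ∀ v ∈ φ.centerList, ∀ w ∈ φ.centerList, v ≠ w →
      (pick v).toFin ∈ φ.nbhd w → (pick w).toFin ∈ φ.nbhd v → False := by
    intro v hv w hw hne h₁ h₂
    rw [mem_centerList] at hv hw
    rcases hv with ⟨x, rfl | rfl⟩ | ⟨j, rfl | ⟨s, rfl⟩⟩ <;>
    rcases hw with ⟨x', rfl | rfl⟩ | ⟨j', rfl | ⟨s', rfl⟩⟩ <;>
    simp only [pick, toFin_mem_nbhd_var, toFin_mem_nbhd_keeper, toFin_mem_nbhd_cls,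
      toFin_mem_nbhd_lit] at h₁ h₂ <;> grind
  -- A teaching map is a function of sets, so a center is chosen for each concept. Distinct concepts
  -- have distinct centers, hence injectivity of `nbhd` is not needed.
  have hex : ∀ B : Finset (Fin φ.order), ∃ t : Finset (Fin φ.order),
      B ∈ φ.toNNCTD.family → ∃ v ∈ φ.centerList, φ.nbhd v = B ∧ t = {(pick v).toFin} := by
    intro B
    by_cases hB : B ∈ φ.toNNCTD.family
    · obtain ⟨v, hv, rfl⟩ := φ.mem_family.1 hB
      exact ⟨_, fun _ => ⟨v, hv, rfl, rfl⟩⟩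
    · exact ⟨∅, fun h => absurd h hB⟩
  choose T hT using hex
  refine ⟨T, ⟨fun B hB => ?_, fun B hB B' hB' hne => ?_⟩, Finset.sup_le fun B hB => ?_⟩
  · obtain ⟨v, hv, rfl, ht⟩ := hT B hB
    rw [ht, Finset.singleton_subset_iff]
    exact hmem v hv
  · obtain ⟨v, hv, rfl, ht⟩ := hT B hB
    obtain ⟨w, hw, rfl, ht'⟩ := hT B' hB'
    by_contra hcon
    push Not at hcon
    refine hpair v hv w hw (fun h => hne (by rw [h])) ?_ ?_
    · have := hcon (pick v).toFin (by simp [ht]) (Finset.mem_union_left _ (hmem v hv))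
      exact (Finset.mem_inter.1 this).2
    · have := hcon (pick w).toFin (by simp [ht']) (Finset.mem_union_right _ (hmem w hw))
      exact (Finset.mem_inter.1 this).1
  · obtain ⟨v, hv, rfl, ht⟩ := hT B hB
    rw [ht, Finset.card_singleton]

theorem satisfiable_of_positiveNCTM {T : Finset (Fin φ.order) → Finset (Fin φ.order)}
    (hT : IsPositiveNCTM φ.toNNCTD.family T) (hsize : teachingSize φ.toNNCTD.family T ≤ 1) :
    φ.Satisfiable := by
  obtain ⟨hsub, hclash⟩ := hT
  have hone : ∀ v ∈ φ.centerList, ∀ a ∈ T (φ.nbhd v), ∀ b ∈ T (φ.nbhd v), a = b := by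
    intro v hv
    refine Finset.card_le_one.1 (le_trans ?_ hsize)
    exact Finset.le_sup (f := fun B => (T B).card) (φ.mem_family.2 ⟨v, hv, rfl⟩)
  have hsub' : ∀ v ∈ φ.centerList, T (φ.nbhd v) ⊆ φ.nbhd v := fun v hv =>
    hsub _ (φ.mem_family.2 ⟨v, hv, rfl⟩)
  have hpair : ∀ v ∈ φ.centerList, ∀ w ∈ φ.centerList, φ.nbhd v ≠ φ.nbhd w →
      (∃ a ∈ T (φ.nbhd v), a ∉ φ.nbhd w) ∨ ∃ a ∈ T (φ.nbhd w), a ∉ φ.nbhd v := by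
    intro v hv w hw hne
    obtain ⟨a, ha, -, ha'⟩ := hclash _ (φ.mem_family.2 ⟨v, hv, rfl⟩) _
      (φ.mem_family.2 ⟨w, hw, rfl⟩) hne
    rw [Finset.mem_inter] at ha'
    rcases Finset.mem_union.1 ha with ha | ha
    · exact Or.inl ⟨a, ha, fun h => ha' ⟨hsub' v hv ha, h⟩⟩
    · exact Or.inr ⟨a, ha, fun h => ha' ⟨h, hsub' w hw ha⟩⟩
  have hcv : ∀ x, var x ∈ φ.centerList := fun x => φ.mem_centerList.2 (Or.inl ⟨x, Or.inl rfl⟩)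
  have hcg : ∀ x, keeper x ∈ φ.centerList := fun x => φ.mem_centerList.2 (Or.inl ⟨x, Or.inr rfl⟩)
  have hcc : ∀ j, cls j ∈ φ.centerList := fun j => φ.mem_centerList.2 (Or.inr ⟨j, Or.inl rfl⟩)
  have hcl : ∀ j s, lit j s ∈ φ.centerList := fun j s =>
    φ.mem_centerList.2 (Or.inr ⟨j, Or.inr ⟨s, rfl⟩⟩)
  -- N[keeper x] is contained in N[var x], so only a vertex of N[var x] outside N[keeper x] can
  -- separate the two, and such a vertex is a value.
  have hval : ∀ x, ∃ b, (val x b).toFin ∈ T (φ.nbhd (var x)) := by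
    intro x
    have hne : φ.nbhd (var x) ≠ φ.nbhd (keeper x) := by
      intro h
      have h₁ : (val x true).toFin ∈ φ.nbhd (var x) := φ.toFin_mem_nbhd_var.2 (by simp)
      rw [h, toFin_mem_nbhd_keeper] at h₁
      simp at h₁
    rcases hpair _ (hcv x) _ (hcg x) hne with ⟨a, ha, ha'⟩ | ⟨a, ha, ha'⟩
    · obtain ⟨u, rfl, -⟩ := φ.mem_nbhd.1 (hsub' _ (hcv x) ha)
      have h₁ := φ.toFin_mem_nbhd_var.1 (hsub' _ (hcv x) ha)
      rw [toFin_mem_nbhd_keeper] at ha'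
      obtain ⟨b, rfl⟩ : ∃ b, u = val x b := by grind
      exact ⟨b, ha⟩
    · obtain ⟨u, rfl, -⟩ := φ.mem_nbhd.1 (hsub' _ (hcg x) ha)
      have h₁ := φ.toFin_mem_nbhd_keeper.1 (hsub' _ (hcg x) ha)
      rw [toFin_mem_nbhd_var] at ha'
      grind
  choose τ hτ using hval
  refine φ.satisfiable_iff.2 ⟨τ, fun j => ?_⟩
  have hlit : ∃ s, ∃ a ∈ T (φ.nbhd (lit j s)), a ∉ φ.nbhd (cls j) := by
    by_contra hcon
    push Not at hcon
    have h₁ : ∀ s, ∃ a ∈ T (φ.nbhd (cls j)), a ∉ φ.nbhd (lit j s) := by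
      intro s
      have hne : φ.nbhd (cls j) ≠ φ.nbhd (lit j s) := by
        intro h
        have h₁ : (link j s).toFin ∈ φ.nbhd (lit j s) := φ.toFin_mem_nbhd_lit.2 (by simp)
        rw [← h, toFin_mem_nbhd_cls] at h₁
        simp at h₁
      rcases hpair _ (hcc j) _ (hcl j s) hne with h | ⟨a, ha, ha'⟩
      · exact h
      · exact absurd (hcon s a ha) ha'
    obtain ⟨a, ha, ha'⟩ := h₁ 0
    -- The clause has at most one example, so the witnesses for the three positions coincide; but
    -- every vertex of N[cls j] lies in some N[lit j s].
    have h₂ : ∀ s, a ∉ φ.nbhd (lit j s) := by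
      intro s
      obtain ⟨b, hb, hb'⟩ := h₁ s
      rwa [hone _ (hcc j) a ha b hb]
    obtain ⟨u, rfl, -⟩ := φ.mem_nbhd.1 (hsub' _ (hcc j) ha)
    rcases φ.toFin_mem_nbhd_cls.1 (hsub' _ (hcc j) ha) with rfl | ⟨s, rfl⟩
    · exact h₂ 0 (φ.toFin_mem_nbhd_lit.2 (by simp))
    · exact h₂ s (φ.toFin_mem_nbhd_lit.2 (by simp))
  obtain ⟨s, a, ha, ha'⟩ := hlit
  refine ⟨s, ?_⟩
  obtain ⟨u, rfl, -⟩ := φ.mem_nbhd.1 (hsub' _ (hcl j s) ha)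
  have h₁ := φ.toFin_mem_nbhd_lit.1 (hsub' _ (hcl j s) ha)
  have h₂ : u.toFin ∈ φ.nbhd (var (φ.clause j s).1) := by
    rw [toFin_mem_nbhd_cls] at ha'
    rw [toFin_mem_nbhd_var]
    rcases h₁ with rfl | rfl | rfl | rfl
    · exact absurd (Or.inr ⟨s, rfl⟩) ha'
    · exact absurd (Or.inl rfl) ha'
    · exact Or.inr (Or.inr (Or.inr ⟨j, s, rfl, rfl⟩))
    · exact Or.inr (Or.inr (Or.inl ⟨_, rfl⟩))
  have hne : φ.nbhd (lit j s) ≠ φ.nbhd (var (φ.clause j s).1) := by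
    intro h
    have h₁ : (lit j s).toFin ∈ φ.nbhd (lit j s) := φ.toFin_mem_nbhd_lit.2 (by simp)
    rw [h, toFin_mem_nbhd_var] at h₁
    simp at h₁
  -- The example of the literal lies in N[var x], so the value `τ x` must do the separating; it
  -- would be adjacent to the literal if it falsified it.
  rcases hpair _ (hcl j s) _ (hcv _) hne with ⟨b, hb, hb'⟩ | ⟨b, hb, hb'⟩
  · rw [hone _ (hcl j s) b hb _ ha] at hb'
    exact absurd h₂ hb'
  · rw [hone _ (hcv _) b hb _ (hτ _), toFin_mem_nbhd_lit] at hb'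
    by_contra hcon
    refine hb' (Or.inr (Or.inr (Or.inr ?_)))
    rw [Bool.eq_not.2 hcon]

theorem toNNCTD_isYes : φ.toNNCTD.IsYes ↔ φ.Satisfiable := by
  constructor
  · intro h
    -- Nonemptiness makes the infimum an attained minimum; `sInf ∅` would be 0.
    have hne : {s | ∃ T, IsPositiveNCTM φ.toNNCTD.family T ∧
        teachingSize φ.toNNCTD.family T = s}.Nonempty :=
      ⟨_, _, exists_isPositiveNCTM φ.toNNCTD.family, rfl⟩
    obtain ⟨T, hT, hs⟩ := Nat.sInf_mem hne
    exact φ.satisfiable_of_positiveNCTM hT (hs.trans_le h)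
  · intro h
    obtain ⟨T, hT, hs⟩ := φ.exists_positiveNCTM_of_satisfiable h
    have hmem : teachingSize φ.toNNCTD.family T ∈ {s | ∃ T, IsPositiveNCTM φ.toNNCTD.family T ∧
        teachingSize φ.toNNCTD.family T = s} := ⟨T, hT, rfl⟩
    exact (Nat.sInf_le hmem).trans hs

/-! ### The size of the graph is linear in n + m. -/

theorem length_edgeList : φ.edgeList.length = 3 * φ.n + 15 * φ.m := by
  simp [edgeList, varEdges, litEdges, List.length_flatMap, mul_comm]

theorem length_centerList : φ.centerList.length = 2 * φ.n + 4 * φ.m := by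
  simp [centerList, List.length_flatMap, mul_comm]

/-- 4n + 7m vertices and at most 3n + 15m edges give 7n + 22m. -/
theorem graphSize_toNNCTD_le : φ.toNNCTD.graphSize ≤ 22 * (φ.n + φ.m) := by
  have h₁ : φ.toNNCTD.graph.edgeFinset ⊆
      (φ.toNNCTD.edges.map fun e => s(e.1, e.2)).toFinset := by
    intro e
    induction e with
    | _ u v =>
      rw [SimpleGraph.mem_edgeFinset, SimpleGraph.mem_edgeSet, List.mem_toFinset, List.mem_map]
      rintro (h | h)
      · exact ⟨_, h, rfl⟩
      · exact ⟨_, h, Sym2.eq_swap⟩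
  have h₂ := (Finset.card_le_card h₁).trans (List.toFinset_card_le _)
  have h₃ : φ.toNNCTD.edges.length = 3 * φ.n + 15 * φ.m := by
    simp [toNNCTD, length_edgeList]
  rw [List.length_map, h₃] at h₂
  have h₄ : Fintype.card (Fin φ.toNNCTD.n) = 4 * φ.n + 7 * φ.m := by
    rw [Fintype.card_fin]; rfl
  unfold NNCTDInstance.graphSize
  omega

end ThreeCNF

/-! ## A program that writes down the reduction -/

namespace StackProgram

variable {P A : Type} [DecidableEq P]

theorem Runs.congr {c : StackProgram P A} {S S' S'' : P → List A} {t t' : ℕ} (h : Runs c S S' t)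
    (hS : S' = S'') (ht : t ≤ t') : Runs c S S'' t' := by
  subst hS
  exact h.mono ht

theorem Runs.loop_cons {p : P} {b : Option A → Bool} {f : Option A → StackProgram P A}
    {S S' S'' : P → List A} {a : A} {w : List A} {t t' : ℕ} (hS : S p = a :: w)
    (hb : b (some a) = true) (h : Runs (f (some a)) (Function.update S p w) S' t)
    (h' : Runs (loop p b f) S' S'' t') : Runs (loop p b f) S S'' (t + t' + 1) := by
  refine .loop_step ?_ ?_ h' <;> rw [hS]
  · exact hb
  · exact h

theorem Runs.loop_end {p : P} {b : Option A → Bool} {f : Option A → StackProgram P A}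
    {S : P → List A} {a : A} {w : List A} (hS : S p = a :: w) (hb : b (some a) = false) :
    Runs (loop p b f) S (Function.update S p w) 1 := by
  have := Runs.loop_exit (p := p) (b := b) (f := f) (S := S) (by rw [hS]; exact hb)
  rwa [hS] at this

theorem Runs.loop_nil {p : P} {b : Option A → Bool} {f : Option A → StackProgram P A}
    {S : P → List A} (hS : S p = []) (hb : b none = false) : Runs (loop p b f) S S 1 := by
  have := Runs.loop_exit (p := p) (b := b) (f := f) (S := S) (by rw [hS]; exact hb)
  rw [hS] at this
  exact this.congr (by rw [List.tail_nil, ← hS, Function.update_eq_self]) le_rfl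

theorem Runs.pop_cons {p : P} {f : Option A → StackProgram P A} {S S' : P → List A} {a : A}
    {w : List A} {t : ℕ} (hS : S p = a :: w) (h : Runs (f (some a)) (Function.update S p w) S' t) :
    Runs (StackProgram.pop p f) S S' (t + 1) := by
  refine .pop ?_
  rw [hS]
  exact h

/-- Push the letters of a word one after the other. -/
def pushWord (p : P) : List A → StackProgram P A
  | [] => skip
  | a :: w => seq (push p a) (pushWord p w)

theorem runs_pushWord (p : P) (w : List A) (S : P → List A) :
    Runs (pushWord p w) S (Function.update S p (w.reverse ++ S p)) (w.length + 1) := by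
  induction w generalizing S with
  | nil => exact (Runs.skip S).congr (by simp) (by simp)
  | cons a w ih =>
    refine ((Runs.push p a S).seq (ih _)).congr ?_ (by simp; omega)
    simp

/-- Empty a stack. -/
def clear (p : P) : StackProgram P A := loop p Option.isSome fun _ => skip

theorem runs_clear (p : P) (S : P → List A) :
    Runs (clear p) S (Function.update S p []) (2 * (S p).length + 1) := by
  generalize hw : S p = w
  induction w generalizing S with
  | nil => exact (Runs.loop_nil hw rfl).congr (by rw [← hw, Function.update_eq_self]) le_rfl
  | cons a w ih =>
    refine (Runs.loop_cons hw rfl (.skip _) (ih _ (by simp))).congr ?_ (by simp; omega)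
    simp

variable [Inhabited A]

/-- Move the contents of a stack to another one. -/
def pour (p q : P) : StackProgram P A := loop p Option.isSome fun a => push q (a.getD default)

theorem runs_pour {p q : P} (hpq : p ≠ q) (S : P → List A) :
    Runs (pour p q) S (Function.update (Function.update S p []) q ((S p).reverse ++ S q))
      (2 * (S p).length + 1) := by
  generalize hw : S p = w
  induction w generalizing S with
  | nil =>
    refine (Runs.loop_nil hw rfl).congr ?_ le_rfl
    rw [← hw, Function.update_eq_self, hw]
    simp
  | cons a w ih =>
    refine (Runs.loop_cons hw rfl (.push _ _ _) (ih _ ?_)).congr ?_ (by simp; omega)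
    · simp [hpq]
    · funext r
      by_cases hr : r = q
      · subst hr; simp [hpq.symm]
      · by_cases hr' : r = p
        · subst hr'; simp [hr]
        · simp [hr, hr']

/-- Move the contents of a stack to two other ones. -/
def pourTwice (p q r : P) : StackProgram P A :=
  loop p Option.isSome fun a => seq (push q (a.getD default)) (push r (a.getD default))

theorem runs_pourTwice {p q r : P} (hpq : p ≠ q) (hpr : p ≠ r) (hqr : q ≠ r) (S : P → List A) :
    Runs (pourTwice p q r) S
      (Function.update (Function.update (Function.update S p []) q ((S p).reverse ++ S q)) r
        ((S p).reverse ++ S r)) (3 * (S p).length + 1) := by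
  generalize hw : S p = w
  induction w generalizing S with
  | nil =>
    refine (Runs.loop_nil hw rfl).congr ?_ le_rfl
    rw [← hw, Function.update_eq_self, hw]
    simp
  | cons a w ih =>
    refine (Runs.loop_cons hw rfl ((Runs.push _ _ _).seq (.push _ _ _)) (ih _ ?_)).congr ?_
      (by simp; omega)
    · simp [hpq, hpr]
    · funext s
      by_cases hs : s = q
      · subst hs; simp [hpq.symm, hqr]
      · by_cases hs' : s = p
        · subst hs'; simp [hpr, hs]
        · by_cases hs'' : s = r
          · subst hs''; simp [hs, hs']
          · simp [hs, hs', hs'']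

/-- Write a copy of a stack to another one. -/
def copy (p tmp q : P) : StackProgram P A := seq (pourTwice p tmp q) (pour tmp p)

/-- Two reversals restore `p`, while `q` receives the reversed word; this is harmless for unary
numbers. A letter costs 3 steps on the way out and 2 on the way back. -/
theorem runs_copy {p tmp q : P} (hp : p ≠ tmp) (hq : p ≠ q) (ht : tmp ≠ q) {S : P → List A}
    (htmp : S tmp = []) :
    Runs (copy p tmp q) S (Function.update S q ((S p).reverse ++ S q)) (5 * (S p).length + 2) := by
  refine ((runs_pourTwice hp hq ht S).seq (runs_pour hp.symm _)).congr ?_ ?_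
  · funext s
    by_cases hs : s = q
    · subst hs; simp [hq.symm, ht.symm]
    · by_cases hs' : s = p
      · subst hs'; simp [hq, hp, ht, htmp]
      · by_cases hs'' : s = tmp
        · subst hs''; simp [hs', hs, htmp]
        · simp [hs, hs', hs'']
  · simp [ht, htmp]
    omega

end StackProgram

/-! ### The reduction with unary counters on stacks. -/

namespace ThreeCNF

open StackProgram

instance : Inhabited Letter := ⟨Letter.bar⟩

/-- The stacks of the program for the reduction. -/
inductive Stack
  /-- the input -/
  | inp
  /-- the number of vertices numbered so far -/
  | cnt
  /-- four times the variable of the current literal -/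
  | lit
  /-- scratch space -/
  | tmp
  /-- the encoding of the edges -/
  | edges
  /-- the encoding of the centers -/
  | centers
  /-- the encoding of the instance -/
  | rev
  /-- the reversed encoding of the instance -/
  | out
  deriving DecidableEq

instance : Fintype Stack where
  elems := {.inp, .cnt, .lit, .tmp, .edges, .centers, .rev, .out}
  complete s := by cases s <;> decide

/-- The contents of the stacks in use before the encodings are put together. -/
def content (i : List Letter) (c l : ℕ) (e z : List ℕ) : Stack → List Letter
  | .inp => i
  | .cnt => List.replicate c .bar
  | .lit => List.replicate l .bar
  | .tmp => []
  | .edges => (e.flatMap encodeNumber).reverse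
  | .centers => (z.flatMap encodeNumber).reverse
  | .rev => []
  | .out => []

section Stacks

variable (i j : List Letter) (c c' l l' : ℕ) (e e' z z' : List ℕ)

theorem update_inp : Function.update (content i c l e z) .inp j = content j c l e z := by
  funext s; cases s <;> simp [content]

theorem update_cnt : Function.update (content i c l e z) .cnt (List.replicate c' .bar) =
    content i c' l e z := by
  funext s; cases s <;> simp [content]

theorem update_lit : Function.update (content i c l e z) .lit (List.replicate l' .bar) =
    content i c l' e z := by
  funext s; cases s <;> simp [content]

theorem update_edges : Function.update (content i c l e z) .edges
    ((e'.flatMap encodeNumber).reverse) = content i c l e' z := by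
  funext s; cases s <;> simp [content]

theorem update_centers : Function.update (content i c l e z) .centers
    ((z'.flatMap encodeNumber).reverse) = content i c l e z' := by
  funext s; cases s <;> simp [content]

end Stacks

/-- Write the number on the stack `p`, increased by `a`, to the stack `q`. -/
def emit (q p : Stack) (a : ℕ) : StackProgram Stack Letter :=
  seq (copy p .tmp q) (pushWord q (encodeNumber a))

theorem runs_emit {q p : Stack} (hp : p ≠ .tmp) (hq : p ≠ q) (ht : .tmp ≠ q)
    {S : Stack → List Letter} (htmp : S .tmp = []) {v : ℕ} (hv : S p = List.replicate v .bar) (a : ℕ) :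
    Runs (emit q p a) S (Function.update S q ((encodeNumber (v + a)).reverse ++ S q))
      (5 * v + a + 4) := by
  refine ((runs_copy hp hq ht htmp).seq (runs_pushWord _ _ _)).congr ?_ ?_
  · simp [hv, encodeNumber, ← List.replicate_append_replicate]
  · simp [hv, encodeNumber]
    omega

/-- Write numbers given by a stack and an increment. -/
def emitAll (q : Stack) : List (Stack × ℕ) → StackProgram Stack Letter
  | [] => skip
  | x :: xs => seq (emit q x.1 x.2) (emitAll q xs)

/-- One `emit` takes at most 5W + 7 + 4 steps; the bound 7 covers all increments inside a gadget. -/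
theorem runs_emitAll {q : Stack} (ht : .tmp ≠ q) {v : Stack → ℕ} {W : ℕ} (xs : List (Stack × ℕ))
    {S : Stack → List Letter} (htmp : S .tmp = [])
    (hxs : ∀ x ∈ xs, x.1 ≠ .tmp ∧ x.1 ≠ q ∧ S x.1 = List.replicate (v x.1) .bar ∧ v x.1 ≤ W ∧
      x.2 ≤ 7) :
    Runs (emitAll q xs) S
      (Function.update S q (((xs.map fun x => v x.1 + x.2).flatMap encodeNumber).reverse ++ S q))
      (xs.length * (5 * W + 11) + 1) := by
  induction xs generalizing S with
  | nil => exact (Runs.skip S).congr (by simp) (by simp)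
  | cons x xs ih =>
    obtain ⟨h₁, h₂, h₃, h₄, h₅⟩ := hxs x (by simp)
    refine ((runs_emit h₁ h₂ ht htmp h₃ x.2).seq (ih ?_ ?_)).congr ?_ ?_
    · rw [Function.update_of_ne ht, htmp]
    · intro y hy
      obtain ⟨k₁, k₂, k₃, k₄, k₅⟩ := hxs y (by simp [hy])
      exact ⟨k₁, k₂, by rw [Function.update_of_ne k₂, k₃], k₄, k₅⟩
    · simp
    · rw [List.length_cons, Nat.add_mul]
      omega

/-- The number on a stack. -/
def stackValue (c l : ℕ) : Stack → ℕ
  | .lit => l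
  | _ => c

theorem runs_emitAll_edges {i : List Letter} {c l W : ℕ} {e z : List ℕ} (xs : List (Stack × ℕ))
    (hc : c ≤ W) (hl : l ≤ W) (hxs : ∀ x ∈ xs, (x.1 = .cnt ∨ x.1 = .lit) ∧ x.2 ≤ 7) :
    Runs (emitAll .edges xs) (content i c l e z)
      (content i c l (e ++ xs.map fun x => stackValue c l x.1 + x.2) z)
      (xs.length * (5 * W + 11) + 1) := by
  refine (runs_emitAll (v := stackValue c l) (W := W) (by simp) xs rfl ?_).congr ?_ le_rfl
  · intro x hx
    obtain ⟨h₁ | h₁, h₂⟩ := hxs x hx <;> simp [h₁, h₂, content, stackValue, hc, hl]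
  · have := update_edges i c l e (e ++ xs.map fun x => stackValue c l x.1 + x.2) z
    rwa [List.flatMap_append, List.reverse_append] at this

theorem runs_emitAll_centers {i : List Letter} {c l W : ℕ} {e z : List ℕ} (xs : List (Stack × ℕ))
    (hc : c ≤ W) (hl : l ≤ W) (hxs : ∀ x ∈ xs, (x.1 = .cnt ∨ x.1 = .lit) ∧ x.2 ≤ 7) :
    Runs (emitAll .centers xs) (content i c l e z)
      (content i c l e (z ++ xs.map fun x => stackValue c l x.1 + x.2))
      (xs.length * (5 * W + 11) + 1) := by
  refine (runs_emitAll (v := stackValue c l) (W := W) (by simp) xs rfl ?_).congr ?_ le_rfl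
  · intro x hx
    obtain ⟨h₁ | h₁, h₂⟩ := hxs x hx <;> simp [h₁, h₂, content, stackValue, hc, hl]
  · have := update_centers i c l e z (z ++ xs.map fun x => stackValue c l x.1 + x.2)
    rwa [List.flatMap_append, List.reverse_append] at this

theorem runs_pushWord_cnt {i : List Letter} {c l : ℕ} {e z : List ℕ} (d : ℕ) :
    Runs (pushWord .cnt (List.replicate d .bar)) (content i c l e z) (content i (c + d) l e z)
      (d + 1) := by
  refine (runs_pushWord _ _ _).congr ?_ (by simp)
  rw [← update_cnt i c (c + d) l e z]
  simp [content, add_comm c d]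

/-- The numbers of the ends of the edges at the variable `x`. -/
def varNumbers (x : ℕ) : List ℕ := [4 * x, 4 * x + 1, 4 * x, 4 * x + 2, 4 * x, 4 * x + 3]

/-- Read the number of variables and write down the variable gadgets. -/
def varProgram : StackProgram Stack Letter :=
  loop .inp (fun a => decide (a = some .bar)) fun _ =>
    seq (emitAll .edges [(.cnt, 0), (.cnt, 1), (.cnt, 0), (.cnt, 2), (.cnt, 0), (.cnt, 3)])
      (seq (emitAll .centers [(.cnt, 0), (.cnt, 1)]) (pushWord .cnt (List.replicate 4 .bar)))

theorem runs_varProgram {i : List Letter} {W : ℕ} (r x : ℕ) {e z : List ℕ} (hW : 4 * (x + r) ≤ W) :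
    Runs varProgram (content (encodeNumber r ++ i) (4 * x) 0 e z)
      (content i (4 * (x + r)) 0 (e ++ (List.range' x r).flatMap varNumbers)
        (z ++ (List.range' x r).flatMap fun x => [4 * x, 4 * x + 1]))
      (r * (100 * (W + 1)) + 1) := by
  induction r generalizing x e z with
  | zero =>
    refine (Runs.loop_end (p := Stack.inp) (a := .comma) (w := i) rfl (by simp)).congr ?_ (by simp)
    rw [update_inp]
    simp
  | succ r ih =>
    -- One round: 6(5W + 11) + 1 steps for the edges, 2(5W + 11) + 1 for the centers, 5 to advance
    -- the counter.
    refine (Runs.loop_cons (p := Stack.inp) (a := .bar) (w := encodeNumber r ++ i)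
      (S' := content (encodeNumber r ++ i) (4 * (x + 1)) 0 (e ++ varNumbers x)
        (z ++ [4 * x, 4 * x + 1])) (t := 40 * W + 95) rfl (by simp) ?_
      (ih (x + 1) (by omega))).congr ?_ ?_
    · rw [update_inp]
      refine ((runs_emitAll_edges (W := W) _ (by omega) (by omega) (by simp)).seq
        ((runs_emitAll_centers (W := W) _ (by omega) (by omega) (by simp)).seq
          (runs_pushWord_cnt 4))).congr ?_ ?_
      · rfl
      · simp only [List.length_cons, List.length_nil]
        omega
    · congr 1
      · ring
      · simp [List.range'_succ, varNumbers]
      · simp [List.range'_succ]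
    · rw [Nat.add_mul]
      omega

/-- Read a variable. -/
def readProgram : StackProgram Stack Letter :=
  loop .inp (fun a => decide (a = some .bar)) fun _ => pushWord .lit (List.replicate 4 .bar)

theorem runs_readProgram {i : List Letter} (x l : ℕ) {c : ℕ} {e z : List ℕ} :
    Runs readProgram (content (encodeNumber x ++ i) c l e z) (content i c (l + 4 * x) e z)
      (6 * x + 1) := by
  induction x generalizing l with
  | zero =>
    refine (Runs.loop_end (p := Stack.inp) (a := .comma) (w := i) rfl (by simp)).congr ?_ (by simp)
    rw [update_inp]
    simp
  | succ x ih =>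
    refine (Runs.loop_cons (p := Stack.inp) (a := .bar) (w := encodeNumber x ++ i)
      (S' := content (encodeNumber x ++ i) c (l + 4) e z) rfl (by simp)
      ((runs_pushWord _ _ _).congr ?_ le_rfl) (ih (l + 4))).congr ?_ ?_
    · rw [update_inp, ← update_lit _ c l (l + 4), List.reverse_replicate, add_comm l 4,
        ← List.replicate_append_replicate]
      rfl
    · congr 1
      ring
    · simp
      omega

/-- The stacks and increments that give the ends of the edges at a literal in position `s`. -/
def litEmits (s : ℕ) (b : Bool) : List (Stack × ℕ) :=
  -- `lit` holds 4x and `cnt` the number of the clause. A positive literal gets increment 3, the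
  -- value `false`, since the edge goes to the falsifying value.
  [(.lit, 0), (.cnt, 2 + 2 * s), (.lit, 1), (.cnt, 2 + 2 * s), (.lit, if b then 3 else 2),
    (.cnt, 1 + 2 * s), (.cnt, 0), (.cnt, 1 + 2 * s), (.cnt, 1 + 2 * s), (.cnt, 2 + 2 * s)]

/-- The numbers of the ends of the edges at a literal in position `s` of a clause with
number `c`. -/
def litNumbers (c s : ℕ) (x : ℕ) (b : Bool) : List ℕ :=
  [4 * x, c + (2 + 2 * s), 4 * x + 1, c + (2 + 2 * s), 4 * x + (if b then 3 else 2),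
    c + (1 + 2 * s), c, c + (1 + 2 * s), c + (1 + 2 * s), c + (2 + 2 * s)]

/-- Write down the gadget of a literal whose sign has been read. -/
def litProgram (s : ℕ) (a : Option Letter) : StackProgram Stack Letter :=
  seq readProgram (seq (emitAll .edges (litEmits s (decide (a = some .plus)))) (clear .lit))

theorem runs_litProgram {i : List Letter} {s x c W : ℕ} (b : Bool) {e z : List ℕ} (hs : s ≤ 2)
    (hx : 4 * x ≤ W) (hc : c ≤ W) :
    Runs (litProgram s (some (if b then Letter.plus else Letter.minus)))
      (content (encodeNumber x ++ i) c 0 e z)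
      (content i c 0 (e ++ litNumbers c s x b) z) (54 * W + 113) := by
  have hb : decide (some (if b then Letter.plus else Letter.minus) = some .plus) = b := by
    cases b <;> simp
  -- Reading takes 6x + 1 steps, ten numbers take 10(5W + 11) + 1, clearing takes 8x + 1; and 14x ≤
  -- 4W.
  refine ((runs_readProgram x 0).seq ((runs_emitAll_edges (W := W) _ hc (by omega) ?_).seq
    (runs_clear .lit _))).congr ?_ ?_
  · intro y hy
    simp only [litEmits, List.mem_cons, List.not_mem_nil, or_false] at hy
    rcases hy with rfl | rfl | rfl | rfl | rfl | rfl | rfl | rfl | rfl | rfl <;> simp <;>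
      first | omega | (split_ifs <;> omega)
  · rw [hb]
    refine (update_lit i c _ 0 _ z).trans ?_
    congr 2
    simp [litEmits, litNumbers, stackValue]
  · simp [litEmits, content]
    omega

/-- The numbers of the ends of the edges of a clause with number `c`. -/
def clauseNumbers {n : ℕ} (c : ℕ) (C : Fin 3 → Fin n × Bool) : List ℕ :=
  litNumbers c 0 (C 0).1 (C 0).2 ++ litNumbers c 1 (C 1).1 (C 1).2 ++ litNumbers c 2 (C 2).1 (C 2).2

/-- Write down the gadgets of the clauses. -/
def clauseProgram : StackProgram Stack Letter :=
  loop .inp Option.isSome fun a =>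
    -- The loop itself has popped the sign of the first literal; the last `pop` discards the
    -- semicolon.
    seq (litProgram 0 a) <| seq (pop .inp (litProgram 1)) <| seq (pop .inp (litProgram 2)) <|
      seq (pop .inp fun _ => emitAll .centers [(.cnt, 0), (.cnt, 1), (.cnt, 3), (.cnt, 5)]) <|
        pushWord .cnt (List.replicate 7 .bar)

/-- The encoding of a clause. -/
def encodeClause {n : ℕ} (C : Fin 3 → Fin n × Bool) : List Letter :=
  encodeLiteral (C 0) ++ encodeLiteral (C 1) ++ encodeLiteral (C 2) ++ [Letter.semicolon]

theorem runs_clauseProgram {n W : ℕ} (Cs : List (Fin 3 → Fin n × Bool)) (d j : ℕ) {e z : List ℕ}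
    (hn : 4 * n ≤ W) (hW : d + 7 * (j + Cs.length) ≤ W) :
    Runs clauseProgram (content (Cs.flatMap encodeClause) (d + 7 * j) 0 e z)
      (content [] (d + 7 * (j + Cs.length)) 0
        (e ++ (Cs.zipIdx j).flatMap fun C => clauseNumbers (d + 7 * C.2) C.1)
        (z ++ (Cs.zipIdx j).flatMap fun C =>
          [d + 7 * C.2, d + 7 * C.2 + 1, d + 7 * C.2 + 3, d + 7 * C.2 + 5]))
      (Cs.length * (400 * (W + 1)) + 1) := by
  induction Cs generalizing j e z with
  | nil =>
    refine (Runs.loop_nil (p := Stack.inp) rfl rfl).congr ?_ (by simp)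
    simp
  | cons C Cs ih =>
    have hC : ∀ s, 4 * ((C s).1 : ℕ) ≤ W := fun s => by have := (C s).1.isLt; omega
    rw [List.length_cons] at hW
    have hc : d + 7 * j ≤ W := by omega
    let i₁ :=
      encodeLiteral (C 1) ++ (encodeLiteral (C 2) ++ (.semicolon :: Cs.flatMap encodeClause))
    have hi : (C :: Cs).flatMap encodeClause =
        (if (C 0).2 then Letter.plus else Letter.minus) :: (encodeNumber (C 0).1 ++ i₁) := by
      simp [i₁, encodeClause, encodeLiteral]
    -- Three literals take 3(54W + 113) steps; the centers, the pops and the counter fit into the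
    -- rest.
    refine (Runs.loop_cons (p := Stack.inp) hi rfl (t := 200 * W + 400)
      (S' := content (Cs.flatMap encodeClause) (d + 7 * (j + 1)) 0
        (e ++ clauseNumbers (d + 7 * j) C)
        (z ++ [d + 7 * j, d + 7 * j + 1, d + 7 * j + 3, d + 7 * j + 5])) ?_
      (ih (j + 1) (by omega))).congr ?_ ?_
    · rw [update_inp]
      refine ((runs_litProgram (C 0).2 (by omega) (hC 0) hc).seq <|
        (Runs.pop_cons (p := Stack.inp) (f := litProgram 1) rfl
          ((congrArg (Runs _ · _ _) (update_inp ..)).mpr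
            (runs_litProgram (C 1).2 one_le_two (hC 1) hc))).seq <|
        (Runs.pop_cons (p := Stack.inp) (f := litProgram 2) rfl
          ((congrArg (Runs _ · _ _) (update_inp ..)).mpr
            (runs_litProgram (C 2).2 le_rfl (hC 2) hc))).seq <|
        (Runs.pop_cons (p := Stack.inp)
          (f := fun _ => emitAll .centers [(.cnt, 0), (.cnt, 1), (.cnt, 3), (.cnt, 5)]) rfl
          ((congrArg (Runs _ · _ _) (update_inp ..)).mpr
          (runs_emitAll_centers (W := W) [(.cnt, 0), (.cnt, 1), (.cnt, 3), (.cnt, 5)] hc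
            (Nat.zero_le W) (by simp)))).seq <|
        runs_pushWord_cnt 7).congr ?_ ?_
      · congr 1
        simp [clauseNumbers]
      · simp only [List.length_cons, List.length_nil]
        omega
    · rw [List.length_cons]
      congr 1
      · ring
      · simp [List.zipIdx_cons]
      · simp [List.zipIdx_cons]
    · rw [List.length_cons, Nat.add_mul]
      omega

/-- Put the encoding of the instance together. -/
def finalProgram : StackProgram Stack Letter :=
  -- The word is built from its end, and each `pour` undoes the reversal in which the parts were
  -- stored. The last one reverses the whole word, as `compose` expects.
  seq (pushWord .rev [.comma, .bar, .semicolon]) <| seq (pour .centers .rev) <|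
    seq (push .rev .semicolon) <| seq (pour .edges .rev) <|
      seq (pushWord .rev [.semicolon, .comma]) <| seq (pour .cnt .rev) <| pour .rev .out

theorem runs_finalProgram {c : ℕ} {e z : List ℕ} {w : List Letter}
    (hw : w = encodeNumber c ++ [.semicolon] ++ e.flatMap encodeNumber ++ [.semicolon] ++
      z.flatMap encodeNumber ++ [.semicolon] ++ encodeNumber 1) :
    Runs finalProgram (content [] c 0 e z) (only .out w.reverse) (8 * w.length + 20) := by
  refine ((runs_pushWord _ _ _).seq <| (runs_pour (by decide) _).seq <| (Runs.push _ _ _).seq <|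
    (runs_pour (by decide) _).seq <| (runs_pushWord _ _ _).seq <| (runs_pour (by decide) _).seq <|
    runs_pour (by decide) _).congr ?_ ?_
  · subst hw
    funext s
    cases s <;> simp [content, only, encodeNumber]
  · subst hw
    simp [content, encodeNumber]
    omega

/-- The program that writes down the reduction. -/
def reductionProgram : StackProgram Stack Letter :=
  seq varProgram (seq clauseProgram finalProgram)

/-! ### The output of the program is the encoded instance. -/

theorem flatMap_finRange_clause (φ : ThreeCNF) {β : Type}
    (F : (Fin 3 → Fin φ.n × Bool) → ℕ → List β) :
    (List.finRange φ.m).flatMap (fun j => F (φ.clause j) j) =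
      φ.clauses.zipIdx.flatMap fun C => F C.1 C.2 := by
  have h : φ.clauses.zipIdx = (List.finRange φ.m).map fun j => (φ.clause j, (j : ℕ)) := by
    refine List.ext_getElem (by simp [m]) fun i h₁ h₂ => ?_
    simp [clause]
    rfl
  rw [h, List.flatMap_map]

theorem flatMap_finRange {n : ℕ} {β : Type} (F : ℕ → List β) :
    (List.finRange n).flatMap (fun x : Fin n => F x) = (List.range' 0 n).flatMap F := by
  rw [← List.range_eq_range', ← List.map_coe_finRange_eq_range, List.flatMap_map]

theorem flatMap_edges_encode (φ : ThreeCNF) :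
    (φ.toNNCTD.edges.flatMap fun e : Fin φ.order × Fin φ.order =>
      encodeNumber (e.1 : ℕ) ++ encodeNumber (e.2 : ℕ)) =
    (φ.edgeList.flatMap fun e => [e.1.toNat, e.2.toNat]).flatMap encodeNumber := by
  rw [List.flatMap_assoc]
  refine (List.flatMap_map _ _ _).trans ?_
  refine congrArg (fun F => List.flatMap F φ.edgeList) (funext fun e => ?_)
  simp [Vertex.toFin]

theorem flatMap_centers_encode (φ : ThreeCNF) :
    (φ.toNNCTD.centers.flatMap fun v : Fin φ.order => encodeNumber (v : ℕ)) =
      (φ.centerList.map Vertex.toNat).flatMap encodeNumber :=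
  (List.flatMap_map _ _ _).trans (List.flatMap_map _ _ _).symm

/-- The right-hand side is the word in the order in which the program emits it: gadget by gadget, in
numbers instead of vertices. -/
theorem encode_toNNCTD (φ : ThreeCNF) : φ.toNNCTD.encode =
    encodeNumber φ.order ++ [.semicolon] ++
      ((List.range' 0 φ.n).flatMap varNumbers ++ φ.clauses.zipIdx.flatMap fun C =>
        clauseNumbers (4 * φ.n + 7 * C.2) C.1).flatMap encodeNumber ++ [.semicolon] ++
      (((List.range' 0 φ.n).flatMap fun x => [4 * x, 4 * x + 1]) ++
        φ.clauses.zipIdx.flatMap fun C : (Fin 3 → Fin φ.n × Bool) × ℕ =>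
          [4 * φ.n + 7 * C.2, 4 * φ.n + 7 * C.2 + 1,
          4 * φ.n + 7 * C.2 + 3, 4 * φ.n + 7 * C.2 + 5]).flatMap encodeNumber ++ [.semicolon] ++
      encodeNumber 1 := by
  rw [← flatMap_finRange_clause φ fun C j => clauseNumbers (4 * φ.n + 7 * j) C,
    ← flatMap_finRange_clause φ fun _ j => [4 * φ.n + 7 * j, 4 * φ.n + 7 * j + 1,
      4 * φ.n + 7 * j + 3, 4 * φ.n + 7 * j + 5], ← flatMap_finRange, ← flatMap_finRange]
  have h₃ : (φ.edgeList.flatMap fun e => [e.1.toNat, e.2.toNat]) =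
      (List.finRange φ.n).flatMap (fun x : Fin φ.n => varNumbers x) ++
        (List.finRange φ.m).flatMap fun j : Fin φ.m =>
          clauseNumbers (4 * φ.n + 7 * j) (φ.clause j) := by
    rw [edgeList, List.flatMap_append, List.flatMap_assoc, List.flatMap_assoc]
    congr 1
    refine congrArg (fun F => List.flatMap F (List.finRange φ.m)) (funext fun j => ?_)
    have hval : ∀ (x : Fin φ.n) (b : Bool), (Vertex.val x !b).toNat = 4 * x + if b then 3 else 2 :=
      fun x b => by cases b <;> rfl
    simp [litEdges, clauseNumbers, litNumbers, hval]
    simp [Vertex.toNat]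
  have h₄ : φ.centerList.map Vertex.toNat =
      (List.finRange φ.n).flatMap (fun x : Fin φ.n => [4 * (x : ℕ), 4 * x + 1]) ++
        (List.finRange φ.m).flatMap fun j : Fin φ.m => [4 * φ.n + 7 * (j : ℕ),
          4 * φ.n + 7 * j + 1, 4 * φ.n + 7 * j + 3, 4 * φ.n + 7 * j + 5] := by
    rw [centerList, List.map_append, List.map_flatMap, List.map_flatMap]
    rfl
  rw [← h₃, ← h₄, ← φ.flatMap_edges_encode, ← φ.flatMap_centers_encode]
  rfl

/-- The program computes the reduction in quadratic time. -/
theorem runs_reductionProgram (φ : ThreeCNF) :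
    Runs reductionProgram (only .inp φ.encode) (only .out φ.toNNCTD.encode.reverse)
      (500 * (φ.n + φ.m) * (φ.order + 1) + 8 * φ.toNNCTD.encode.length + 22) := by
  have h₁ := runs_varProgram (i := φ.clauses.flatMap encodeClause) (W := φ.order) φ.n 0
    (e := []) (z := []) (by simp [order])
  have h₂ := runs_clauseProgram (W := φ.order) φ.clauses (4 * φ.n) 0
    (e := (List.range' 0 φ.n).flatMap varNumbers)
    (z := (List.range' 0 φ.n).flatMap fun x => [4 * x, 4 * x + 1]) (by simp [order])
    (by simp [order, m])
  have h₃ := runs_finalProgram φ.encode_toNNCTD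
  have e₁ : only .inp φ.encode =
      content (encodeNumber φ.n ++ φ.clauses.flatMap encodeClause) (4 * 0) 0 [] [] := by
    funext s
    cases s <;> rfl
  rw [e₁]
  have e₂ : 4 * φ.n + 7 * (0 + φ.clauses.length) = φ.order := by simp [order, m]
  rw [e₂] at h₂
  simp only [zero_add, List.nil_append, mul_zero, add_zero] at h₁ h₂
  refine (h₁.seq (h₂.seq h₃)).congr rfl ?_
  have : φ.clauses.length = φ.m := rfl
  rw [this]
  -- The factors 100 per variable and 400 per clause are both at most 500.
  nlinarith [Nat.zero_le (φ.n * (φ.order + 1)), Nat.zero_le (φ.m * (φ.order + 1))]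

/-- The strict inequality `a < N` pays for the comma. -/
theorem length_flatMap_encodeNumber_le {N : ℕ} (l : List ℕ) (h : ∀ a ∈ l, a < N) :
    (l.flatMap encodeNumber).length ≤ l.length * N := by
  induction l with
  | nil => simp
  | cons a l ih =>
    have := h a (by simp)
    have := ih fun b hb => h b (by simp [hb])
    simp only [List.flatMap_cons, List.length_append, encodeNumber, List.length_replicate,
      List.length_cons, List.length_nil, Nat.add_mul]
    omega

/-- The instance has quadratic length. -/
theorem length_encode_toNNCTD_le (φ : ThreeCNF) :
    φ.toNNCTD.encode.length ≤ 300 * (φ.n + φ.m + 1) ^ 2 := by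
  have h₃ := length_flatMap_encodeNumber_le (N := φ.order)
    (φ.edgeList.flatMap fun e => [e.1.toNat, e.2.toNat]) (by
      intro a ha
      obtain ⟨e, -, he⟩ := List.mem_flatMap.1 ha
      simp only [List.mem_cons, List.not_mem_nil, or_false] at he
      rcases he with rfl | rfl <;> exact Vertex.toNat_lt _)
  have h₄ := length_flatMap_encodeNumber_le (N := φ.order) (φ.centerList.map Vertex.toNat) (by
      intro a ha
      obtain ⟨v, -, rfl⟩ := List.mem_map.1 ha
      exact Vertex.toNat_lt _)
  have h₅ : (φ.edgeList.flatMap fun e => [e.1.toNat, e.2.toNat]).length =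
      2 * (3 * φ.n + 15 * φ.m) := by
    rw [← length_edgeList]
    simp [List.length_flatMap, mul_comm]
  rw [h₅, ← flatMap_edges_encode] at h₃
  rw [List.length_map, length_centerList, ← flatMap_centers_encode] at h₄
  have h₆ : φ.toNNCTD.encode.length = φ.order + 1 + 1 +
      (φ.toNNCTD.edges.flatMap fun e : Fin φ.order × Fin φ.order =>
        encodeNumber (e.1 : ℕ) ++ encodeNumber (e.2 : ℕ)).length +
      1 + (φ.toNNCTD.centers.flatMap fun v : Fin φ.order => encodeNumber (v : ℕ)).length + 1 + 2 := by
    simp only [NNCTDInstance.encode, List.length_append]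
    rw [show (encodeNumber φ.toNNCTD.n).length = φ.order + 1 by simp [encodeNumber],
      show (encodeNumber φ.toNNCTD.k).length = 2 by simp [encodeNumber]]
    simp only [List.length_singleton]
  rw [h₆]
  unfold order at *
  nlinarith [Nat.zero_le φ.n, Nat.zero_le φ.m, Nat.zero_le (φ.n * φ.m)]

end ThreeCNF

/-! ## Growth of the running time -/

/-- `G x` is the maximum of |g(C y)| over y ≤ D x, which is needed because g may be neither monotone
nor nonnegative. It is o(x) because |g z| ≤ ε'z + K for all z, where K collects the finitely many
early values. -/
theorem exists_isLittleO_bound {g : ℕ → ℝ} (hg : g =o[atTop] (fun x : ℕ => (x : ℝ))) (C D : ℕ) :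
    ∃ G : ℕ → ℝ, G =o[atTop] (fun x : ℕ => (x : ℝ)) ∧
      ∀ x, 0 ≤ G x ∧ ∀ y ≤ D * x, g (C * y) ≤ G x := by
  have hmax : ∀ x, ∃ y ≤ D * x, ∀ z ≤ D * x, |g (C * z)| ≤ |g (C * y)| := by
    intro x
    obtain ⟨y, hy, h⟩ := Finset.exists_max_image (Finset.range (D * x + 1)) (fun y => |g (C * y)|)
      ⟨0, by simp⟩
    exact ⟨y, Nat.lt_succ_iff.1 (Finset.mem_range.1 hy),
      fun z hz => h z (Finset.mem_range.2 (Nat.lt_succ_iff.2 hz))⟩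
  choose y hy hmax using hmax
  refine ⟨fun x => |g (C * y x)|, ?_, fun x => ⟨abs_nonneg _, fun z hz =>
    (le_abs_self _).trans (hmax x z hz)⟩⟩
  rw [isLittleO_iff]
  intro ε hε
  -- Half of ε goes to the linear term, half to K; the `+ 1` keeps the denominator positive when C D
  -- = 0.
  have hε' : 0 < ε / (2 * (C * D + 1)) := by positivity
  obtain ⟨N, hN⟩ := eventually_atTop.1 (isLittleO_iff.1 hg hε')
  set K : ℝ := ∑ i ∈ Finset.range N, |g i| with hK
  have hbound : ∀ z, |g z| ≤ ε / (2 * (C * D + 1)) * z + K := by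
    intro z
    rcases lt_or_ge z N with h | h
    · have h₁ : |g z| ≤ K := Finset.single_le_sum (f := fun i => |g i|)
        (fun i _ => abs_nonneg _) (Finset.mem_range.2 h)
      have : 0 ≤ ε / (2 * (C * D + 1)) * (z : ℝ) := by positivity
      linarith
    · have h₁ := hN z h
      simp only [Real.norm_eq_abs, Nat.abs_cast] at h₁
      have : 0 ≤ K := Finset.sum_nonneg fun i _ => abs_nonneg _
      linarith
  filter_upwards [eventually_ge_atTop ⌈2 * K / ε⌉₊] with x hx
  have hx' : 2 * K / ε ≤ x := Nat.ceil_le.1 hx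
  rw [div_le_iff₀ hε] at hx'
  simp only [Real.norm_eq_abs, abs_abs, Nat.abs_cast]
  refine (hbound _).trans ?_
  have h₁ : ((C * y x : ℕ) : ℝ) ≤ C * D * x := by
    have : C * y x ≤ C * D * x := by
      rw [mul_assoc]
      exact Nat.mul_le_mul_left _ (hy x)
    exact_mod_cast this
  have h₂ : ε / (2 * (C * D + 1)) * ((C * y x : ℕ) : ℝ) ≤ ε / 2 * x := by
    calc ε / (2 * (C * D + 1)) * ((C * y x : ℕ) : ℝ)
        ≤ ε / (2 * (C * D + 1)) * ((C * D + 1) * x) := by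
          gcongr
          refine h₁.trans ?_
          gcongr
          linarith
      _ = ε / 2 * x := by field_simp
  linarith

theorem Polynomial.eval_le_eval_one_mul_pow (R : Polynomial ℕ) {x : ℕ} (hx : 1 ≤ x) :
    R.eval x ≤ R.eval 1 * x ^ R.natDegree := by
  rw [Polynomial.eval_eq_sum_range, Polynomial.eval_eq_sum_range, Finset.sum_mul]
  refine Finset.sum_le_sum fun i hi => ?_
  rw [one_pow, mul_one]
  exact Nat.mul_le_mul_left _ (Nat.pow_le_pow_right hx (Nat.lt_succ_iff.1 (Finset.mem_range.1 hi)))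

/-- For x ≥ 1 the polynomial is at most R(1)x^d, so its logarithm is O(1 + log x). The `+ 1` keeps
the argument of the logarithm at least 1. -/
theorem isLittleO_logb_polynomial (R : Polynomial ℕ) :
    (fun x : ℕ => Real.logb 2 ((R.eval x : ℕ) + 1)) =o[atTop] (fun x : ℕ => (x : ℝ)) := by
  have hlog : (fun x : ℕ => Real.log x) =o[atTop] (fun x : ℕ => (x : ℝ)) :=
    Real.isLittleO_log_id_atTop.comp_tendsto tendsto_natCast_atTop_atTop
  have hconst : (fun _ : ℕ => Real.log ((R.eval 1 : ℕ) + 1)) =o[atTop] (fun x : ℕ => (x : ℝ)) :=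
    (isLittleO_const_id_atTop _).comp_tendsto tendsto_natCast_atTop_atTop
  have hsum := (hconst.add (hlog.const_mul_left (R.natDegree : ℝ))).const_mul_left (Real.log 2)⁻¹
  refine IsBigO.trans_isLittleO (IsBigO.of_bound 1 ?_) hsum
  filter_upwards [eventually_ge_atTop 1] with x hx
  have hx' : (1 : ℝ) ≤ x := by exact_mod_cast hx
  have h2 : 0 < Real.log 2 := Real.log_pos one_lt_two
  have h₁ : 0 ≤ Real.log ((R.eval x : ℕ) + 1) :=
    Real.log_nonneg (by linarith [Nat.cast_nonneg (α := ℝ) (R.eval x)])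
  have h₂ : Real.log ((R.eval x : ℕ) + 1) ≤
      Real.log ((R.eval 1 : ℕ) + 1) + R.natDegree * Real.log x := by
    rw [← Real.log_pow, ← Real.log_mul (by positivity) (by positivity)]
    refine Real.log_le_log (by positivity) ?_
    have h₃ : ((R.eval x : ℕ) : ℝ) ≤ (R.eval 1 : ℕ) * (x : ℝ) ^ R.natDegree := by
      exact_mod_cast R.eval_le_eval_one_mul_pow hx
    have h₄ : (1 : ℝ) ≤ (x : ℝ) ^ R.natDegree := one_le_pow₀ hx'
    nlinarith
  rw [one_mul, Real.norm_of_nonneg (Real.logb_nonneg one_lt_two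
    (by linarith [Nat.cast_nonneg (α := ℝ) (R.eval x)])), Real.logb, div_eq_inv_mul]
  refine le_trans ?_ (le_abs_self _)
  gcongr

/-! ### The lower bound. -/

theorem theorem3 (hETH : ExponentialTimeHypothesis) (f : ℕ → ℕ) (hf : Computable f) :
    ¬ ∃ (g : ℕ → ℝ) (p : Polynomial ℕ), g =o[atTop] (fun x : ℕ => (x : ℝ)) ∧
      SolvableInTime NNCTDInstance.encode NNCTDInstance.IsYes fun I =>
        (2 : ℝ) ^ g (f I.k * I.graphSize) * (p.eval I.encode.length : ℕ) := by
  rintro ⟨g, p, hg, M, hM⟩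
  obtain ⟨G, hG, hGg⟩ := exists_isLittleO_bound hg (f 1) 22
  set Q : Polynomial ℕ := 300 * (Polynomial.X + 1) ^ 2 with hQ
  -- 9Q is 8L for the reduction and L for moving its output, with L ≤ Q(x); 23 = 22 + 1 collects the
  -- constants, and the last summand bounds the polynomial factor of the solver.
  set R : Polynomial ℕ :=
    500 * Polynomial.X * (7 * Polynomial.X + 1) + 9 * Q + 23 + p.comp Q with hR
  refine hETH ⟨fun x => G x + Real.logb 2 ((R.eval x : ℕ) + 1),
    hG.add (isLittleO_logb_polynomial R),
    StackProgram.compose ThreeCNF.reductionProgram .inp .out M, fun φ => ?_⟩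
  obtain ⟨b, s, hb, hs, hrun⟩ := hM φ.toNNCTD
  refine ⟨b, _, hb.trans φ.toNNCTD_isYes, ?_,
    StackProgram.compose_outputs φ.runs_reductionProgram hrun⟩
  set x := φ.n + φ.m with hx
  set L := φ.toNNCTD.encode.length with hL
  have hLQ : L ≤ Q.eval x := by
    have := φ.length_encode_toNNCTD_le
    simpa [hQ] using this
  have hLp : p.eval L ≤ p.eval (Q.eval x) := by
    rw [Polynomial.eval_eq_sum_range, Polynomial.eval_eq_sum_range]
    exact Finset.sum_le_sum fun i _ => Nat.mul_le_mul_left _ (Nat.pow_le_pow_left hLQ _)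
  have hord : φ.order ≤ 7 * x := by
    unfold ThreeCNF.order
    omega
  have hReval : R.eval x = 500 * x * (7 * x + 1) + 9 * Q.eval x + 23 + p.eval (Q.eval x) := by
    simp [hR, Polynomial.eval_comp]
  have h₁ : (500 * x * (φ.order + 1) + 8 * L + 22 + (L + 1)) + p.eval L ≤ R.eval x := by
    rw [hReval]
    have : 500 * x * (φ.order + 1) ≤ 500 * x * (7 * x + 1) := by gcongr
    omega
  obtain ⟨hG₀, hG₁⟩ := hGg x
  have h₂ : (s : ℝ) ≤ (2 : ℝ) ^ G x * (p.eval L : ℕ) := by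
    have h : (s : ℝ) ≤ (2 : ℝ) ^ g (f 1 * φ.toNNCTD.graphSize) * (p.eval L : ℕ) := hs
    exact h.trans (mul_le_mul_of_nonneg_right (Real.rpow_le_rpow_of_exponent_le one_le_two
      (hG₁ _ φ.graphSize_toNNCTD_le)) (Nat.cast_nonneg _))
  have h₃ : (1 : ℝ) ≤ (2 : ℝ) ^ G x := Real.one_le_rpow one_le_two hG₀
  change _ ≤ (2 : ℝ) ^ (G x + Real.logb 2 ((R.eval x : ℕ) + 1))
  rw [Real.rpow_add two_pos, Real.rpow_logb two_pos (by norm_num) (by positivity)]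
  have h₄ : ((500 * x * (φ.order + 1) + 8 * L + 22 + (L + 1) : ℕ) : ℝ) + (p.eval L : ℕ) ≤
      (R.eval x : ℕ) := by exact_mod_cast h₁
  rw [Nat.cast_add]
  have h₅ : (0 : ℝ) ≤ ((500 * x * (φ.order + 1) + 8 * L + 22 + (L + 1) : ℕ) : ℝ) :=
    Nat.cast_nonneg _
  have h₆ : ((p.eval L : ℕ) : ℝ) * (2 : ℝ) ^ G x ≤ ((R.eval x : ℕ) -
      ((500 * x * (φ.order + 1) + 8 * L + 22 + (L + 1) : ℕ) : ℝ)) * (2 : ℝ) ^ G x := by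
    gcongr
    linarith
  generalize ((500 * x * (φ.order + 1) + 8 * L + 22 + (L + 1) : ℕ) : ℝ) = a at *
  -- Since 2^G ≥ 1, the overhead a is at most a · 2^G, and the total is at most R(x) · 2^G.
  nlinarith
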